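/- **Proposition.** Let $G=(V,E)$ be an infinite, connected, locally finite, vertex-transitive simple graph, and let $o\in V$. For $p\in[0,1]$, let $\mathrm P_p$ denote Bernoulli bond percolation on $G$, under which each edge is open with probability $p$ independently of all other edges, and let $\{o\leftrightarrow\infty\}$ be the event that the set of vertices connected to $o$ by open edges is infinite. For a finite set $S\subset V$, let $\partial S$ be the set of edges with exactly one endpoint in $S$, let $$\Phi(S):=\min\{|\partial S'| : S\subset S'\subset V,\ |S'|<\infty\},$$ and let $\Psi(S)$ be the number of edges $e\in\partial S$ such that the set of vertices connected to an endpoint of $e$ by paths of open edges having both endpoints in $V\setminus S$ is infinite (the edge $e$ itself need not be open). Let $p\in[0,1]$ be such that $\mathrm P_p(o\leftrightarrow\infty)>0$. Then for all $q\in(p,1)$ and all $\varepsilon\in(0,1]$, there exists $c>0$ such that for every finite set of vertices $S$ and every positive integer $t$ with $t\le c\,\Phi(S)$, $$\mathrm P_q(\Psi(S)\ge t)\ge(1-\varepsilon)^t .$$ -/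

import Mathlib

namespace Percolation

open MeasureTheory ProbabilityTheory

variable {V : Type*}

/-- `G` is (vertex-)transitive: its automorphism group acts transitively on the vertices. -/
def IsTransitive (G : SimpleGraph V) : Prop :=
  ∀ u v : V, ∃ φ : G ≃g G, φ u = v

/-- The edge boundary `∂S`: the edges of `G` with exactly one endpoint in `S`. -/
def edgeBoundary (G : SimpleGraph V) (S : Set V) : Set (Sym2 V) :=
  {e | e ∈ G.edgeSet ∧ ∃ x ∈ S, ∃ y ∉ S, e = s(x, y)}

/-- The edges `A°` of `G` with both endpoints in `A`. -/
def innerEdges (G : SimpleGraph V) (A : Set V) : Set (Sym2 V) :=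
  {e | e ∈ G.edgeSet ∧ ∀ v ∈ e, v ∈ A}

/-- In a locally finite graph, the edge boundary of a finite set is finite (so that `Set.ncard` is
its number of elements). -/
theorem edgeBoundary_finite (G : SimpleGraph V) [G.LocallyFinite] {S : Set V} (hS : S.Finite) :
    (edgeBoundary G S).Finite := by
  refine (hS.biUnion fun x _ => (Set.toFinite (G.neighborSet x)).image fun y => s(x, y)).subset ?_
  rintro e ⟨he, x, hx, y, -, rfl⟩
  exact Set.mem_biUnion hx ⟨y, he, rfl⟩

/-- `Φ(W) = min {|∂S| : W ⊆ S ⊆ V, |S| < ∞}`. For finite `W` the set of competitors is nonempty,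
so the infimum in `ℕ` is a minimum. -/
noncomputable def isoperimetric (G : SimpleGraph V) (W : Set V) : ℕ :=
  sInf {n | ∃ S : Set V, W ⊆ S ∧ S.Finite ∧ (edgeBoundary G S).ncard = n}

/-- Percolation configurations: elements of `{0,1}^E`, where `true` means open. -/
abbrev Config (G : SimpleGraph V) : Type _ := G.edgeSet → Bool

/-- The percolation measure `P_p`: every edge is open with probability `p`, independently of all
other edges. -/
noncomputable def percMeasure (G : SimpleGraph V) (p : unitInterval) : Measure (Config G) :=
  Measure.infinitePi fun _ : G.edgeSet => bernoulliMeasure true false p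

/-- The support of a configuration: its set of open edges. -/
def openEdges {G : SimpleGraph V} (ω : Config G) : Set (Sym2 V) :=
  {e | ∃ he : e ∈ G.edgeSet, ω ⟨e, he⟩ = true}

/-- `L ↔ ∞` in the graph `(V, F)`: the set of vertices connected to `L` in the graph with vertex
set `V` and edge set `F` is infinite. -/
def ConnectedToInfinity (F : Set (Sym2 V)) (L : Set V) : Prop :=
  {v : V | ∃ u ∈ L, (SimpleGraph.fromEdgeSet F).Reachable u v}.Infinite

/-- `Ψ(S)`: the number of edges `e ∈ ∂S` that are connected to infinity off `S`, that is, using only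
open edges with both endpoints in `V \ S`. An edge is identified with the set of its endpoints;
the edge `e` itself may be open or closed. -/
noncomputable def touches {G : SimpleGraph V} (S : Set V) (ω : Config G) : ℕ :=
  {e | e ∈ edgeBoundary G S ∧
    ConnectedToInfinity (openEdges ω ∩ innerEdges G Sᶜ) {v | v ∈ e}}.ncard

end Percolation

/-! The core is the bound P_q(Ψ(S) < t) ≤ ε^t for t ≤ cΦ(S); the claim follows since 1 - ε^t ≥ 1 - ε
≥ (1 - ε)^t. Infinity is first replaced by the complement of a finite ball Λ ⊇ S, and P_q is
realised as the union of three independent fields: field 0 with parameter p, fields 1 and 2 with a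
parameter s > 0 such that (1 - p)(1 - s)² = 1 - q.

Clusters are explored by successive trials. Every explored vertex off S is connected, by edges known
to be open, to the complement of Λ, to a neighbour of S, or to one of a finite set Q of pending
vertices. While fewer than t edges of ∂S are touched, S together with the explored vertices tied to
S but not to Λᶜ, and with the unexplored vertices whose local field-0 cluster is likely to reach
these, forms a finite set with at least Φ(S) boundary edges. So one boundary edge xy is untouched
and far from all earlier trials (`exists_trial_edge`). A trial at xy asks that all field-1 edges of
a link set L near x be open, then reveals the field-0 cluster of a seed around x and y, then the
field-2 edges from it to explored vertices.

Let j be the number of touched edges. A success halves the weight 2^|Q| / 2^j: it touches a new edge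
or resolves a pending vertex (`Explored.next_success`). It has probability at least s^|L| s²/8, by
Harris' inequality (`success_prob`). The weight at most doubles when the cluster stays isolated and
becomes pending. This has probability at most s^|L| (η + (1 - s)^r) (`creation_prob`), where η
bounds the chance that the field-0 cluster of a ball of radius R has fewer than r exits. Since both
bounds carry the factor s^|L|, r and η can be chosen in terms of s alone, and R afterwards. Each
trial then multiplies the expected weight by at most some ρ < 1 (`touched_lt_prob_le`), and kt
trials give 2^t ρ^(kt) ≤ ε^t.

The bound η comes from percolation at p: a large ball meets an infinite cluster with probability
close to 1, whereas a cluster with few exits would be cut off from infinity at bounded cost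
(`measureReal_outEdges_lt`). -/

namespace Percolation

open MeasureTheory ProbabilityTheory

/-! ### Product Bernoulli measures: independence, Harris' inequality, conditioning on finite-range
variables -/

section ProductSpace

variable {ι : Type*}

/-- The product of Bernoulli measures with parameters `a i`. -/
noncomputable def bernProd (a : ι → unitInterval) : Measure (ι → Bool) :=
  Measure.infinitePi fun i => bernoulliMeasure true false (a i)

instance (a : ι → unitInterval) : IsProbabilityMeasure (bernProd a) := by
  unfold bernProd; infer_instance

/-- The event `A` is determined by the coordinates in `I`. -/
def Determined (A : Set (ι → Bool)) (I : Set ι) : Prop :=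
  ∀ x y : ι → Bool, (∀ i ∈ I, x i = y i) → x ∈ A → y ∈ A

theorem Determined.mono {A : Set (ι → Bool)} {I J : Set ι} (h : Determined A I) (hIJ : I ⊆ J) :
    Determined A J :=
  fun x y hxy hx => h x y (fun i hi => hxy i (hIJ hi)) hx

theorem Determined.inter {A B : Set (ι → Bool)} {I : Set ι} (hA : Determined A I)
    (hB : Determined B I) : Determined (A ∩ B) I :=
  fun x y hxy hx => ⟨hA x y hxy hx.1, hB x y hxy hx.2⟩

theorem Determined.compl {A : Set (ι → Bool)} {I : Set ι} (hA : Determined A I) :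
    Determined Aᶜ I :=
  fun x y hxy hx hy => hx (hA y x (fun i hi => (hxy i hi).symm) hy)

open Classical in
/-- Extension of a partial configuration by `false`. -/
noncomputable def extendFalse (I : Set ι) (z : I → Bool) : ι → Bool :=
  fun i => if h : i ∈ I then z ⟨i, h⟩ else false

theorem measurable_extendFalse (I : Set ι) : Measurable (extendFalse I) := by
  refine measurable_pi_iff.2 fun i => ?_
  by_cases h : i ∈ I
  · simpa [extendFalse, h] using measurable_pi_apply (⟨i, h⟩ : I)
  · simp [extendFalse, h]

/-- Restriction to a set of coordinates. -/
def restr (I : Set ι) (x : ι → Bool) : I → Bool := fun i => x i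

theorem Determined.eq_preimage {A : Set (ι → Bool)} {I : Set ι} (hA : Determined A I) :
    A = restr I ⁻¹' (extendFalse I ⁻¹' A) := by
  ext x
  constructor
  · intro hx
    exact hA x _ (fun i hi => by simp [extendFalse, restr, hi]) hx
  · intro hx
    exact hA _ x (fun i hi => by simp [extendFalse, restr, hi]) hx

theorem measurable_restr (I : Set ι) : Measurable (restr I) :=
  measurable_pi_iff.2 fun i => measurable_pi_apply (i : ι)

theorem Determined.measurableSet {A : Set (ι → Bool)} {I : Set ι} (hA : Determined A I)
    (hI : I.Finite) : MeasurableSet A := by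
  have := hI.to_subtype
  rw [hA.eq_preimage]
  exact measurable_restr I (Set.toFinite _).measurableSet

/-- The coordinates are independent, hence so are the σ-algebras generated by disjoint families of
them; a measurable event determined by I lies in the one generated by I, being a preimage under
restriction to I. -/
theorem indep_of_determined (a : ι → unitInterval) {A B : Set (ι → Bool)} {I J : Set ι}
    (hA : Determined A I) (hB : Determined B J) (hIJ : Disjoint I J) (mA : MeasurableSet A)
    (mB : MeasurableSet B) :
    (bernProd a).real (A ∩ B) = (bernProd a).real A * (bernProd a).real B := by
  have h1 : iIndepFun (fun i (ω : ι → Bool) => ω i) (bernProd a) :=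
    iIndepFun_infinitePi (P := fun i => bernoulliMeasure true false (a i))
      (X := fun _ x => x) (fun _ => measurable_id)
  have h2 := indep_iSup_of_disjoint (fun i => (measurable_pi_apply i).comap_le) h1 hIJ
  have key : ∀ {A : Set (ι → Bool)} {I : Set ι}, Determined A I → MeasurableSet A →
      MeasurableSet[⨆ i ∈ I, MeasurableSpace.comap (fun ω : ι → Bool => ω i) inferInstance] A := by
    intro A I hA mA
    rw [hA.eq_preimage]
    have hm : Measurable[⨆ i ∈ I, MeasurableSpace.comap (fun ω : ι → Bool => ω i) inferInstance]
        (restr I) := by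
      refine (@measurable_pi_iff (ι → Bool) I (fun _ => Bool)
        (⨆ i ∈ I, MeasurableSpace.comap (fun ω : ι → Bool => ω i) inferInstance) _
        (restr I)).2 fun i => ?_
      have : Measurable[MeasurableSpace.comap (fun ω : ι → Bool => ω (i : ι)) inferInstance]
          (fun x : ι → Bool => restr I x i) := comap_measurable _
      exact this.mono (le_iSup₂_of_le (i : ι) i.2 le_rfl) le_rfl
    exact hm (measurable_extendFalse I mA)
  have h3 := (Indep_iff _ _ _).1 h2 A B (key hA mA) (key hB mB)
  simp only [measureReal_def, h3, ENNReal.toReal_mul]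

theorem indep_of_determined_finite (a : ι → unitInterval) {A B : Set (ι → Bool)} {I J : Set ι}
    (hA : Determined A I) (hB : Determined B J) (hIJ : Disjoint I J) (hI : I.Finite)
    (hJ : J.Finite) :
    (bernProd a).real (A ∩ B) = (bernProd a).real A * (bernProd a).real B :=
  indep_of_determined a hA hB hIJ (hA.measurableSet hI) (hB.measurableSet hJ)

theorem bernProd_eval_true (a : ι → unitInterval) (i : ι) :
    (bernProd a).real {ω | ω i = true} = a i := by
  have h := Measure.infinitePi_map_eval (fun i => bernoulliMeasure true false (a i)) i
  have h2 : (bernProd a).real {ω | ω i = true}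
      = (bernoulliMeasure true false (a i)).real {true} := by
    rw [← h, map_measureReal_apply (measurable_pi_apply i) (MeasurableSet.singleton _)]
    rfl
  rw [h2, bernoulliMeasure_real_apply _ (MeasurableSet.singleton _)]
  simp

theorem bernProd_eval_false (a : ι → unitInterval) (i : ι) :
    (bernProd a).real {ω | ω i = false} = 1 - a i := by
  have h : {ω : ι → Bool | ω i = false} = {ω | ω i = true}ᶜ := by ext; simp
  rw [h, probReal_compl_eq_one_sub, bernProd_eval_true]
  exact (measurable_pi_apply (X := fun _ : ι => Bool) i) (MeasurableSet.singleton true)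

theorem bernProd_eval (a : ι → unitInterval) (i : ι) (b : Bool) :
    (bernProd a).real {ω | ω i = b} = if b then (a i : ℝ) else 1 - a i := by
  cases b <;> simp [bernProd_eval_true, bernProd_eval_false]

theorem bernProd_all (a : ι → unitInterval) (F : Finset ι) (b : ι → Bool) :
    (bernProd a).real {ω | ∀ i ∈ F, ω i = b i} = ∏ i ∈ F, if b i then (a i : ℝ) else 1 - a i := by
  classical
  induction F using Finset.induction_on with
  | empty => simp
  | insert i F hi ih =>
    have h : {ω : ι → Bool | ∀ j ∈ insert i F, ω j = b j}
        = {ω | ω i = b i} ∩ {ω | ∀ j ∈ F, ω j = b j} := by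
      ext ω; simp
    rw [h, indep_of_determined_finite a (I := {i}) (J := F), ih, bernProd_eval,
      Finset.prod_insert hi]
    · intro x y hxy hx
      simpa [← hxy i rfl] using hx
    · intro x y hxy hx j hj
      rw [← hxy j hj]; exact hx j hj
    · simpa using hi
    · exact Set.finite_singleton i
    · exact F.finite_toSet

/-- **Harris' inequality** for events determined by finitely many coordinates. -/
theorem harris (a : ι → unitInterval) {A B : Set (ι → Bool)} {I : Set ι} (hI : I.Finite)
    (hA : Determined A I) (hB : Determined B I) (uA : IsUpperSet A) (uB : IsUpperSet B) :
    (bernProd a).real A * (bernProd a).real B ≤ (bernProd a).real (A ∩ B) := by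
  classical
  have hfin : Finite I := hI.to_subtype
  have := Fintype.ofFinite I
  have hsingle : ∀ z : I → Bool, (bernProd a).real (restr I ⁻¹' {z})
      = ∏ i : I, if z i then (a i : ℝ) else 1 - a i := by
    intro z
    have h : restr I ⁻¹' {z} = {ω : ι → Bool | ∀ i ∈ hI.toFinset, ω i = extendFalse I z i} := by
      ext ω
      simp only [Set.mem_preimage, Set.mem_singleton_iff, Set.mem_ofPred_eq, Set.Finite.mem_toFinset]
      constructor
      · rintro rfl i hi; simp [extendFalse, restr, hi]
      · intro h; funext i; simpa [extendFalse, restr] using h i i.2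
    rw [h, bernProd_all]
    refine Finset.prod_bij' (fun i hi => ⟨i, by simpa using hi⟩) (fun i _ => (i : ι)) ?_ ?_ ?_ ?_ ?_
    · simp
    · simp
    · simp
    · simp
    · intro i hi
      have hi' : i ∈ I := by simpa using hi
      simp [extendFalse, hi']
  set w : (I → Bool) → ℝ := fun z => ∏ i : I, if z i then (a i : ℝ) else 1 - a i with hw
  have hsum : ∀ {A : Set (ι → Bool)}, Determined A I → (bernProd a).real A
      = ∑ z, w z * (if extendFalse I z ∈ A then 1 else 0) := by
    intro A hA
    have h : A = ⋃ z ∈ Finset.univ.filter (fun z => extendFalse I z ∈ A), restr I ⁻¹' {z} := by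
      ext ω
      have := Set.ext_iff.1 hA.eq_preimage ω
      simp only [Set.mem_preimage] at this
      simp [this]
    conv_lhs => rw [h]
    rw [measureReal_biUnion_finset, Finset.sum_filter]
    · refine Finset.sum_congr rfl fun z _ => ?_
      rw [hsingle]; split_ifs <;> simp [hw]
    · intro z _ z' _ hzz'
      refine Set.disjoint_left.2 fun ω h1 h2 => hzz' ?_
      rw [Set.mem_preimage, Set.mem_singleton_iff] at h1 h2
      rw [← h1, h2]
    · intro z _
      exact measurable_restr I (MeasurableSet.singleton z)
  have hmono : ∀ {A : Set (ι → Bool)}, IsUpperSet A →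
      Monotone fun z : I → Bool => if extendFalse I z ∈ A then (1 : ℝ) else 0 := by
    intro A uA z z' hzz'
    have : extendFalse I z ≤ extendFalse I z' := by
      intro i
      by_cases hi : i ∈ I
      · simpa [extendFalse, hi] using hzz' ⟨i, hi⟩
      · simp [extendFalse, hi]
    dsimp only
    split_ifs with h1 h2
    · exact le_rfl
    · exact absurd (uA this h1) h2
    · exact zero_le_one
    · exact le_rfl
  have hone : ∑ z, w z = 1 := by
    have := hsum (A := Set.univ) (fun _ _ _ _ => trivial)
    simpa using this.symm
  have hf0 : ∀ {A : Set (ι → Bool)},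
      (0 : (I → Bool) → ℝ) ≤ fun z => if extendFalse I z ∈ A then (1 : ℝ) else 0 := by
    intro A z
    dsimp only [Pi.zero_apply]
    split_ifs <;> norm_num
  have hw0 : 0 ≤ w := by
    intro z
    refine Finset.prod_nonneg fun i _ => ?_
    split_ifs
    · exact (a i).2.1
    · exact sub_nonneg.2 (a i).2.2
  -- Product weights satisfy the FKG lattice condition with equality: at each coordinate the minimum
  -- and the maximum are the two given values in some order.
  have hlat : ∀ z z', w z * w z' ≤ w (z ⊓ z') * w (z ⊔ z') := by
    intro z z'
    rw [hw]
    dsimp only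
    rw [← Finset.prod_mul_distrib, ← Finset.prod_mul_distrib]
    refine le_of_eq (Finset.prod_congr rfl fun i _ => ?_)
    simp only [Pi.inf_apply, Pi.sup_apply]
    rcases Bool.eq_false_or_eq_true (z i) with h | h <;>
      rcases Bool.eq_false_or_eq_true (z' i) with h' | h' <;> simp [h, h', mul_comm]
  have := fkg _ _ _ hw0 hf0 hf0 (hmono uA) (hmono uB) hlat
  rw [hone, one_mul] at this
  rw [hsum hA, hsum hB, hsum (hA.inter hB)]
  refine this.trans (le_of_eq (Finset.sum_congr rfl fun z _ => ?_))
  by_cases h1 : extendFalse I z ∈ A <;> by_cases h2 : extendFalse I z ∈ B <;> simp [h1, h2]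

/-- Decomposition of an event along a random variable with finite range whose fibres are
independent of the corresponding slices of the event. -/
theorem measureReal_eq_sum_fibers (a : ι → unitInterval) {T : Type*} (τ : (ι → Bool) → T)
    (D : T → Set (ι → Bool)) (I J : T → Set ι) (N : Finset T) (hN : ∀ ω, τ ω ∈ N)
    (hτ : ∀ t ∈ N, Determined (τ ⁻¹' {t}) (I t)) (hD : ∀ t ∈ N, Determined (D t) (J t))
    (hIJ : ∀ t ∈ N, Disjoint (I t) (J t)) (hI : ∀ t ∈ N, (I t).Finite)
    (hJ : ∀ t ∈ N, (J t).Finite) :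
    (bernProd a).real {ω | ω ∈ D (τ ω)}
      = ∑ t ∈ N, (bernProd a).real (τ ⁻¹' {t}) * (bernProd a).real (D t) := by
  have h : {ω | ω ∈ D (τ ω)} = ⋃ t ∈ N, (τ ⁻¹' {t} ∩ D t) := by
    ext ω
    simp only [Set.mem_ofPred_eq, Set.mem_iUnion, Set.mem_inter_iff, Set.mem_preimage,
      Set.mem_singleton_iff, exists_prop]
    constructor
    · intro hω; exact ⟨τ ω, hN ω, rfl, hω⟩
    · rintro ⟨t, _, rfl, hω⟩; exact hω
  rw [h, measureReal_biUnion_finset]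
  · refine Finset.sum_congr rfl fun t ht => ?_
    exact indep_of_determined_finite a (hτ t ht) (hD t ht) (hIJ t ht) (hI t ht) (hJ t ht)
  · intro t _ t' _ htt'
    refine Set.disjoint_left.2 fun ω h1 h2 => htt' ?_
    rw [← h1.1, ← h2.1]
  · intro t ht
    exact ((hτ t ht).measurableSet (hI t ht)).inter ((hD t ht).measurableSet (hJ t ht))

theorem measureReal_preimage_eq_sum (a : ι → unitInterval) {T : Type*} (τ : (ι → Bool) → T)
    (I : T → Set ι) (N : Finset T) (hN : ∀ ω, τ ω ∈ N)
    (hτ : ∀ t ∈ N, Determined (τ ⁻¹' {t}) (I t)) (hI : ∀ t ∈ N, (I t).Finite)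
    (P : T → Prop) [DecidablePred P] :
    (bernProd a).real {ω | P (τ ω)} = ∑ t ∈ N, if P t then (bernProd a).real (τ ⁻¹' {t}) else 0 := by
  have := measureReal_eq_sum_fibers a τ (fun t => {_ω | P t}) I (fun _ => ∅) N hN hτ
    (fun t _ x y _ hx => hx) (fun _ _ => Set.disjoint_empty _) hI (fun _ _ => Set.finite_empty)
  rw [show {ω | P (τ ω)} = {ω | ω ∈ {_ω : ι → Bool | P (τ ω)}} from rfl, this]
  refine Finset.sum_congr rfl fun t _ => ?_
  by_cases h : P t <;> simp [h]

end ProductSpace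

/-! ### Deterministic exploration: how a trial changes the state -/

section Deterministic

variable {V : Type*} {G : SimpleGraph V}

/-- Coordinates of three independent percolation fields on the edges of `G`. -/
abbrev Coord (G : SimpleGraph V) : Type _ := G.edgeSet × Fin 3

/-- The graph whose edges are those of the coordinates in `O`. -/
def edgeGraph (O : Set (Coord G)) : SimpleGraph V where
  Adj u v := ∃ i ∈ O, (i.1 : Sym2 V) = s(u, v)
  symm := ⟨fun u v ⟨i, hi, h⟩ => ⟨i, hi, h.trans Sym2.eq_swap⟩⟩
  loopless := ⟨fun v ⟨i, _, h⟩ => G.irrefl (v := v) (by simpa [h] using i.1.2)⟩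

theorem edgeGraph_mono {O O' : Set (Coord G)} (h : O ⊆ O') : edgeGraph O ≤ edgeGraph O' :=
  fun _ _ ⟨i, hi, he⟩ => ⟨i, h hi, he⟩

/-- The open coordinates in `A`. -/
def openSet (A : Set (Coord G)) (ω : Coord G → Bool) : Set (Coord G) := {i | i ∈ A ∧ ω i = true}

theorem openSet_mono {A B : Set (Coord G)} (h : A ⊆ B) (ω : Coord G → Bool) :
    openSet A ω ⊆ openSet B ω := fun _ hi => ⟨h hi.1, hi.2⟩

theorem openSet_congr {A : Set (Coord G)} {ω ω' : Coord G → Bool} (h : ∀ i ∈ A, ω i = ω' i) :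
    openSet A ω = openSet A ω' := by
  ext i
  simp only [openSet, Set.mem_ofPred_eq]
  exact and_congr_right fun hi => by rw [h i hi]

theorem openSet_le {A : Set (Coord G)} {ω ω' : Coord G → Bool} (h : ω ≤ ω') :
    openSet A ω ⊆ openSet A ω' := fun i hi => ⟨hi.1, by
      have := h i; rw [hi.2] at this; exact top_le_iff.1 this⟩

variable (G)

/-- `v` has a neighbour in `S`. -/
def AdjTo (S : Set V) (v : V) : Prop := ∃ u ∈ S, G.Adj u v

/-- `v` is connected in `K` to a vertex outside `Λ`. -/
def Far (Λ : Set V) (K : SimpleGraph V) (v : V) : Prop := ∃ w, w ∉ Λ ∧ K.Reachable v w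

/-- The edges of `∂S` whose outer endpoint is connected to the complement of `Λ` in `K`. -/
def touchedEdges (S Λ : Set V) (K : SimpleGraph V) : Set (Sym2 V) :=
  {e | e ∈ edgeBoundary G S ∧ ∃ v ∈ e, v ∉ S ∧ Far Λ K v}

/-- The explored vertices connected to the neighbourhood of `S`, but not to the complement of `Λ`. -/
def nearSide (S Λ U : Set V) (K : SimpleGraph V) : Set V :=
  {v | v ∉ S ∧ v ∉ U ∧ ¬ Far Λ K v ∧ ∃ w, AdjTo G S w ∧ K.Reachable v w}

/-- The other explored vertices. -/
def otherSide (S Λ U : Set V) (K : SimpleGraph V) : Set V :=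
  {v | v ∉ S ∧ v ∉ U ∧ v ∉ nearSide G S Λ U K}

/-- The state of the exploration: `U` is the set of unexplored vertices, `K` consists of known open
edges between explored vertices off `S`, and every explored vertex is connected in `K` to the
complement of `Λ`, to a neighbour of `S`, or to a vertex of `Q`. -/
structure Explored (S Λ U : Set V) (K : SimpleGraph V) (Q : Finset V) : Prop where
  subset : U ⊆ Λ
  notMem : ∀ v ∈ U, v ∉ S
  adj : ∀ u v, K.Adj u v → u ∉ S ∧ u ∉ U
  cover : ∀ v, v ∉ S → v ∉ U →
    Far Λ K v ∨ (∃ w, AdjTo G S w ∧ K.Reachable v w) ∨ ∃ q ∈ Q, K.Reachable v q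

variable {G} {S Λ U : Set V} {K K' : SimpleGraph V} {Q : Finset V} {C : Set V}

theorem Far.mono {v : V} (h : Far Λ K v) (hK : K ≤ K') : Far Λ K' v :=
  let ⟨w, hw, h⟩ := h
  ⟨w, hw, h.mono hK⟩

theorem touchedEdges_mono (hK : K ≤ K') : touchedEdges G S Λ K ⊆ touchedEdges G S Λ K' :=
  fun _ ⟨he, v, hv, hS, hf⟩ => ⟨he, v, hv, hS, hf.mono hK⟩

theorem eq_of_reachable_of_forall_not_adj {v w : V} (h : K.Reachable v w)
    (hv : ∀ u, ¬ K.Adj v u) : v = w := by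
  obtain ⟨p⟩ := h
  cases p with
  | nil => rfl
  | cons h _ => exact absurd h (hv _)

/-- An unexplored vertex is isolated in K and lies in Λ. -/
theorem Explored.not_far (h : Explored G S Λ U K Q) {v : V} (hv : v ∈ U) : ¬ Far Λ K v := by
  rintro ⟨w, hw, hr⟩
  have := eq_of_reachable_of_forall_not_adj hr fun u hu => (h.adj _ _ hu).2 hv
  exact hw (this ▸ h.subset hv)

/-- No new pending vertex is needed: a vertex of C that is tied to an explored vertex inherits the
alternative which that vertex already satisfies. -/
theorem Explored.next_joined (h : Explored G S Λ U K Q) (hK : K ≤ K')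
    (hadj : ∀ u v, K'.Adj u v → u ∉ S ∧ (u ∉ U ∨ u ∈ C))
    (hj : ∀ v ∈ C, (∃ w, AdjTo G S w ∧ K'.Reachable v w) ∨
      ∃ z, z ∉ S ∧ z ∉ U ∧ K'.Reachable v z) :
    Explored G S Λ (U \ C) K' Q where
  subset := Set.sdiff_subset.trans h.subset
  notMem v hv := h.notMem v hv.1
  adj u v huv := ⟨(hadj u v huv).1, fun hu => (hadj u v huv).2.elim (· hu.1) hu.2⟩
  cover := by
    have key : ∀ z, z ∉ S → z ∉ U →
        Far Λ K' z ∨ (∃ w, AdjTo G S w ∧ K'.Reachable z w) ∨ ∃ q ∈ Q, K'.Reachable z q := by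
      intro z hS hU
      rcases h.cover z hS hU with h | ⟨w, hw, hr⟩ | ⟨q, hq, hr⟩
      · exact Or.inl (h.mono hK)
      · exact Or.inr (Or.inl ⟨w, hw, hr.mono hK⟩)
      · exact Or.inr (Or.inr ⟨q, hq, hr.mono hK⟩)
    intro v hS hU
    by_cases hvU : v ∈ U
    · have hvC : v ∈ C := by
        by_contra hC; exact hU ⟨hvU, hC⟩
      rcases hj v hvC with hw | ⟨z, hzS, hzU, hr⟩
      · exact Or.inr (Or.inl hw)
      · rcases key z hzS hzU with ⟨w, hw, hr'⟩ | ⟨w, hw, hr'⟩ | ⟨q, hq, hr'⟩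
        · exact Or.inl ⟨w, hw, hr.trans hr'⟩
        · exact Or.inr (Or.inl ⟨w, hw, hr.trans hr'⟩)
        · exact Or.inr (Or.inr ⟨q, hq, hr.trans hr'⟩)
    · exact key v hS hvU

-- The unfavourable case: C is attached to nothing known, and c becomes its pending representative.
open Classical in
theorem Explored.next_new (h : Explored G S Λ U K Q) (hK : K ≤ K')
    (hadj : ∀ u v, K'.Adj u v → u ∉ S ∧ (u ∉ U ∨ u ∈ C)) (c : V)
    (hc : ∀ v ∈ C, K'.Reachable v c) :
    Explored G S Λ (U \ C) K' (insert c Q) where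
  subset := Set.sdiff_subset.trans h.subset
  notMem v hv := h.notMem v hv.1
  adj u v huv := ⟨(hadj u v huv).1, fun hu => (hadj u v huv).2.elim (· hu.1) hu.2⟩
  cover := by
    intro v hS hU
    by_cases hvU : v ∈ U
    · have hvC : v ∈ C := by
        by_contra hC; exact hU ⟨hvU, hC⟩
      exact Or.inr (Or.inr ⟨c, Finset.mem_insert_self _ _, hc v hvC⟩)
    · rcases h.cover v hS hvU with h | ⟨w, hw, hr⟩ | ⟨q, hq, hr⟩
      · exact Or.inl (h.mono hK)
      · exact Or.inr (Or.inl ⟨w, hw, hr.mono hK⟩)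
      · exact Or.inr (Or.inr ⟨q, Finset.mem_insert_of_mem hq, hr.mono hK⟩)

-- A vertex z of the other side is connected in K to Λᶜ or to a pending q. In the first case w
-- becomes connected to Λᶜ, so an edge from S to w is newly touched; in the second q becomes
-- connected to the neighbour w of S, and is no longer needed in Q.
open Classical in
theorem Explored.next_success (h : Explored G S Λ U K Q) (hK : K ≤ K')
    (hadj : ∀ u v, K'.Adj u v → u ∉ S ∧ (u ∉ U ∨ u ∈ C))
    (hj : ∀ v ∈ C, (∃ w, AdjTo G S w ∧ K'.Reachable v w) ∨
      ∃ z, z ∉ S ∧ z ∉ U ∧ K'.Reachable v z)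
    (hs : ∃ w z, AdjTo G S w ∧ w ∉ S ∧ ¬ Far Λ K w ∧ z ∈ otherSide G S Λ U K ∧
      K'.Reachable w z) :
    (Explored G S Λ (U \ C) K' Q ∧ ∃ e ∈ touchedEdges G S Λ K', e ∉ touchedEdges G S Λ K) ∨
      ∃ q ∈ Q, Explored G S Λ (U \ C) K' (Q.erase q) := by
  have hJ := h.next_joined hK hadj hj
  obtain ⟨w, z, hw, hwS, hwf, ⟨hzS, hzU, hzn⟩, hr⟩ := hs
  have hz : Far Λ K z ∨ ∃ q ∈ Q, K.Reachable z q := by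
    rcases h.cover z hzS hzU with h | h | h
    · exact Or.inl h
    · refine Or.inl ?_
      by_contra hf
      exact hzn ⟨hzS, hzU, hf, h⟩
    · exact Or.inr h
  rcases hz with ⟨z', hz', hrz⟩ | ⟨q, hq, hrq⟩
  · left
    refine ⟨hJ, ?_⟩
    obtain ⟨u, huS, huw⟩ := hw
    refine ⟨s(u, w), ⟨⟨huw, u, huS, w, hwS, rfl⟩, w, Sym2.mem_mk_right _ _, hwS, z', hz',
      hr.trans (hrz.mono hK)⟩, ?_⟩
    rintro ⟨-, v, hv, hvS, hvf⟩
    rcases Sym2.mem_iff.1 hv with rfl | rfl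
    · exact hvS huS
    · exact hwf hvf
  · right
    refine ⟨q, hq, hJ.subset, hJ.notMem, hJ.adj, fun v hvS hvU => ?_⟩
    rcases hJ.cover v hvS hvU with h | h | ⟨q', hq', hr'⟩
    · exact Or.inl h
    · exact Or.inr (Or.inl h)
    · by_cases hqq : q' = q
      · subst hqq
        exact Or.inr (Or.inl ⟨w, hw, hr'.trans ((hrq.symm.mono hK).trans hr.symm)⟩)
      · exact Or.inr (Or.inr ⟨q', Finset.mem_erase.2 ⟨hqq, hq'⟩, hr'⟩)

/-! ### Local structure -/

theorem exists_adj_dist_le (hG : G.Connected) {w v : V} {n : ℕ} (h : G.dist w v = n + 1) :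
    ∃ u, G.Adj u v ∧ G.dist w u ≤ n := by
  obtain ⟨p, hp⟩ := (hG v w).exists_walk_length_eq_dist
  rw [G.dist_comm, h] at hp
  cases p with
  | nil => simp at hp
  | cons hadj p =>
    rename_i u
    refine ⟨u, hadj.symm, ?_⟩
    rw [G.dist_comm]
    exact (G.dist_le p).trans (by simpa using hp.le)

variable (G)

/-- The graph induced on the part of `U` in the ball of radius `R` around `w`. -/
def localGraph (U : Set V) (R : ℕ) (w : V) : SimpleGraph V where
  Adj u v := G.Adj u v ∧ (u ∈ U ∧ G.dist w u ≤ R) ∧ v ∈ U ∧ G.dist w v ≤ R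
  symm := ⟨fun _ _ h => ⟨h.1.symm, h.2.2, h.2.1⟩⟩
  loopless := ⟨fun _ h => G.irrefl h.1⟩

/-- The component of `w` in the part of `U` in the ball of radius `R` around `w`. -/
def localSet (U : Set V) (R : ℕ) (w : V) : Set V :=
  {v | w ∈ U ∧ (localGraph G U R w).Reachable w v}

variable {G} {R : ℕ}

theorem mem_localSet_self {w : V} (hw : w ∈ U) : w ∈ localSet G U R w :=
  ⟨hw, SimpleGraph.Reachable.refl _⟩

theorem localSet_induction {w : V} {P : V → Prop} (hw : w ∈ U → P w)
    (hstep : ∀ u v, u ∈ localSet G U R w → v ∈ localSet G U R w → G.Adj u v → P u → P v) :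
    ∀ v ∈ localSet G U R w, P v := by
  rintro v ⟨hwU, hr⟩
  rw [SimpleGraph.reachable_iff_reflTransGen] at hr
  induction hr with
  | refl => exact hw hwU
  | tail h1 h2 ih =>
    rw [← SimpleGraph.reachable_iff_reflTransGen] at h1
    exact hstep _ _ ⟨hwU, h1⟩ ⟨hwU, h1.trans h2.reachable⟩ h2.1 ih

theorem localSet_subset {w v : V} (h : v ∈ localSet G U R w) : v ∈ U ∧ G.dist w v ≤ R := by
  obtain ⟨hw, hr⟩ := h
  rw [SimpleGraph.reachable_iff_reflTransGen] at hr
  induction hr with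
  | refl => exact ⟨hw, by simp⟩
  | tail h1 h2 ih => exact h2.2.2

theorem mem_localSet_of_adj {w u v : V} (hu : u ∈ localSet G U R w) (huv : G.Adj u v)
    (hv : v ∈ U) (hd : G.dist w v ≤ R) : v ∈ localSet G U R w :=
  ⟨hu.1, hu.2.trans (SimpleGraph.Adj.reachable ⟨huv, localSet_subset hu, hv, hd⟩)⟩

/-- Along a geodesic from w, either every vertex lies in U, so that the end is in the local
component, or the first vertex outside U provides the exit. -/
theorem mem_localSet_or_exit (hG : G.Connected) {w : V} (hw : w ∈ U) :
    ∀ v, G.dist w v ≤ R → v ∈ localSet G U R w ∨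
      ∃ u u', u ∈ localSet G U R w ∧ u' ∉ U ∧ G.Adj u u' ∧ G.dist w u' ≤ R := by
  have : ∀ n ≤ R, ∀ v, G.dist w v ≤ n → v ∈ localSet G U R w ∨
      ∃ u u', u ∈ localSet G U R w ∧ u' ∉ U ∧ G.Adj u u' ∧ G.dist w u' ≤ R := by
    intro n
    induction n with
    | zero =>
      intro _ v hv
      have : w = v := (hG.dist_eq_zero_iff).1 (Nat.le_zero.1 hv)
      exact Or.inl (this ▸ mem_localSet_self hw)
    | succ n ih =>
      intro hn v hv
      rcases Nat.lt_or_ge (G.dist w v) (n + 1) with h | h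
      · exact ih (by omega) v (by omega)
      · obtain ⟨u, huv, hu⟩ := exists_adj_dist_le hG (le_antisymm hv h)
        rcases ih (by omega) u hu with h' | h'
        · by_cases hvU : v ∈ U
          · exact Or.inl (mem_localSet_of_adj h' huv hvU (by omega))
          · exact Or.inr ⟨u, v, h', hvU, huv, by omega⟩
        · exact Or.inr h'
  exact this R le_rfl

end Deterministic

/-! ### The outcome of a trial, and the coordinates it uses or leaves unused -/

section Trial

variable {V : Type*} {G : SimpleGraph V}

/-- The coordinate of the edge `uv` in the field `k`. -/
def coord {u v : V} (h : G.Adj u v) (k : Fin 3) : Coord G := (⟨s(u, v), h⟩, k)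

@[simp] theorem coord_fst {u v : V} (h : G.Adj u v) (k : Fin 3) :
    ((coord h k).1 : Sym2 V) = s(u, v) := rfl

@[simp] theorem coord_snd {u v : V} (h : G.Adj u v) (k : Fin 3) : (coord h k).2 = k := rfl

/-- The coordinates of the first field inside `U`. -/
def inner (G : SimpleGraph V) (U : Set V) : Set (Coord G) :=
  {i | i.2 = 0 ∧ ∀ v ∈ (i.1 : Sym2 V), v ∈ U}

/-- The vertices connected to `b` inside `U` by edges that are open in the first field. -/
def cluster (U b : Set V) (ω : Coord G → Bool) : Set V :=
  {v | ∃ u ∈ b, (edgeGraph (openSet (inner G U) ω)).Reachable u v}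

theorem subset_cluster {U b : Set V} {ω : Coord G → Bool} : b ⊆ cluster U b ω :=
  fun v hv => ⟨v, hv, SimpleGraph.Reachable.refl _⟩

theorem cluster_induction {U b : Set V} {ω : Coord G → Bool} {P : V → Prop}
    (hb : ∀ v ∈ b, P v)
    (hstep : ∀ u v, ∀ i ∈ inner G U, u ∈ cluster U b ω → ω i = true → (i.1 : Sym2 V) = s(u, v) →
      P u → P v) :
    ∀ v ∈ cluster U b ω, P v := by
  rintro v ⟨u, hu, hr⟩
  rw [SimpleGraph.reachable_iff_reflTransGen] at hr
  induction hr with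
  | refl => exact hb _ hu
  | tail h1 h2 ih =>
    rw [← SimpleGraph.reachable_iff_reflTransGen] at h1
    obtain ⟨i, hi, he⟩ := h2
    exact hstep _ _ i hi.1 ⟨u, hu, h1⟩ hi.2 he ih

theorem mem_cluster_step {U b : Set V} {ω : Coord G → Bool} {u v : V} {i : Coord G}
    (hi : i ∈ inner G U) (hu : u ∈ cluster U b ω) (hω : ω i = true)
    (he : (i.1 : Sym2 V) = s(u, v)) : v ∈ cluster U b ω := by
  obtain ⟨w, hw, hr⟩ := hu
  exact ⟨w, hw, hr.trans (SimpleGraph.Adj.reachable ⟨i, ⟨hi, hω⟩, he⟩)⟩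

theorem cluster_subset {U b : Set V} {ω : Coord G → Bool} (hb : b ⊆ U) : cluster U b ω ⊆ U :=
  cluster_induction (P := (· ∈ U)) (fun _ hv => hb hv) fun u v i hi _ _ he _ =>
    hi.2 v (by rw [he]; exact Sym2.mem_mk_right _ _)

theorem cluster_mono {U b b' : Set V} {ω ω' : Coord G → Bool} (hb : b ⊆ b') (hω : ω ≤ ω') :
    cluster U b ω ⊆ cluster U b' ω' :=
  fun _ ⟨u, hu, hr⟩ => ⟨u, hb hu, hr.mono (edgeGraph_mono (openSet_le hω))⟩

/-- The coordinates of the first field inside `U` meeting `C`. -/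
def innerTouching (G : SimpleGraph V) (U C : Set V) : Set (Coord G) :=
  {i | i.2 = 0 ∧ (∀ v ∈ (i.1 : Sym2 V), v ∈ U) ∧ ∃ v ∈ (i.1 : Sym2 V), v ∈ C}

/-- Growing the cluster inspects only edges inside U that meet it. Edges of U disjoint from C, and
edges leaving U, remain fresh. -/
theorem determined_cluster (U b C : Set V) :
    Determined {ω : Coord G → Bool | cluster U b ω = C} (innerTouching G U C) := by
  intro x y hxy hx
  have hx : cluster U b x = C := hx
  subst hx
  refine Set.Subset.antisymm ?_ ?_
  · refine cluster_induction (fun v hv => subset_cluster hv) fun u v i hi _ hy he hu => ?_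
    refine mem_cluster_step hi hu ?_ he
    rw [hxy i ⟨hi.1, hi.2, u, by rw [he]; exact Sym2.mem_mk_left _ _, hu⟩, hy]
  · refine cluster_induction (fun v hv => subset_cluster hv) fun u v i hi huc hx he hu => ?_
    refine mem_cluster_step hi hu ?_ he
    rw [← hxy i ⟨hi.1, hi.2, u, by rw [he]; exact Sym2.mem_mk_left _ _, huc⟩, hx]

theorem cluster_congr {U b : Set V} {x y : Coord G → Bool} (h : ∀ i ∈ inner G U, x i = y i) :
    cluster U b x = cluster U b y := by
  have := determined_cluster (G := G) U b (cluster U b x) x y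
    (fun i hi => h i ⟨hi.1, hi.2.1⟩) rfl
  exact this.symm

/-- The coordinates of the second field used in a trial around `x` with seed `b`. -/
def linkSet (G : SimpleGraph V) (S Λ U : Set V) (R : ℕ) (x : V) (b : Set V) : Set (Coord G) :=
  {i | i.2 = 1 ∧ (∀ v ∈ (i.1 : Sym2 V), G.dist x v ≤ R + 1 ∧ v ∉ S ∧ (v ∈ b ∨ v ∉ U)) ∧
    ∃ v ∈ (i.1 : Sym2 V), v ∈ Λ}

/-- The coordinates revealed by a trial that discovers the cluster `C`. -/
def revealSet (G : SimpleGraph V) (S Λ U : Set V) (R : ℕ) (x : V) (b C : Set V) : Set (Coord G) :=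
  linkSet G S Λ U R x b ∪ innerTouching G U C ∪
    {i | i.2 = 2 ∧ (∀ v ∈ (i.1 : Sym2 V), v ∉ S ∧ (v ∈ C ∨ v ∉ U)) ∧ ∃ v ∈ (i.1 : Sym2 V), v ∈ C}

/-- The coordinates not yet used, when `U` is unexplored and trials around the vertices of `Y` have
been made. -/
def aliveSet (G : SimpleGraph V) (S Λ U : Set V) (R : ℕ) (Y : Finset V) : Set (Coord G) :=
  inner G U ∪
    {i | i.2 = 1 ∧ (∀ v ∈ (i.1 : Sym2 V), v ∉ S) ∧ (∃ v ∈ (i.1 : Sym2 V), v ∈ Λ) ∧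
      ∀ c ∈ Y, ∃ v ∈ (i.1 : Sym2 V), R + 1 < G.dist c v} ∪
    {i | i.2 = 2 ∧ (∀ v ∈ (i.1 : Sym2 V), v ∉ S) ∧ ∃ v ∈ (i.1 : Sym2 V), v ∈ U}

/-- The known open edges together with the open alive coordinates. -/
def finalGraph (K : SimpleGraph V) (A : Set (Coord G)) (ω : Coord G → Bool) : SimpleGraph V :=
  K ⊔ edgeGraph (openSet A ω)

open Classical in
/-- The outcome of a trial: `none` if some coordinate of the link set is closed, and otherwise the
cluster of the seed and the revealed open coordinates. -/
noncomputable def trial (S Λ U : Set V) (R : ℕ) (x : V) (b : Set V) (ω : Coord G → Bool) :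
    Option (Set V × Set (Coord G)) :=
  if ∀ i ∈ linkSet G S Λ U R x b, ω i = true then
    some (cluster U b ω, openSet (revealSet G S Λ U R x b (cluster U b ω)) ω)
  else none

/-- The coordinates that determine whether a trial has the outcome `t`. -/
def trialSet (G : SimpleGraph V) (S Λ U : Set V) (R : ℕ) (x : V) (b : Set V) :
    Option (Set V × Set (Coord G)) → Set (Coord G)
  | none => linkSet G S Λ U R x b
  | some t => revealSet G S Λ U R x b t.1

variable {S Λ U : Set V} {R : ℕ} {x y : V} {b : Set V} {Y : Finset V}

theorem determined_link (L : Set (Coord G)) :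
    Determined {ω : Coord G → Bool | ∀ i ∈ L, ω i = true} L :=
  fun x y hxy hx i hi => by rw [← hxy i hi]; exact hx i hi

theorem trial_eq_some {ω : Coord G → Bool} {t : Set V × Set (Coord G)} :
    trial S Λ U R x b ω = some t ↔ (∀ i ∈ linkSet G S Λ U R x b, ω i = true) ∧
      cluster U b ω = t.1 ∧ openSet (revealSet G S Λ U R x b t.1) ω = t.2 := by
  unfold trial
  split_ifs with h
  · rw [Option.some_inj]
    constructor
    · rintro rfl; exact ⟨h, rfl, rfl⟩
    · rintro ⟨-, h1, h2⟩
      rw [← h1] at h2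
      exact Prod.ext h1 h2
  · exact ⟨fun h' => (nomatch h'), fun h' => absurd h'.1 h⟩

theorem trial_eq_none {ω : Coord G → Bool} :
    trial S Λ U R x b ω = none ↔ ¬ ∀ i ∈ linkSet G S Λ U R x b, ω i = true := by
  unfold trial
  split_ifs with h
  · exact ⟨fun h' => (nomatch h'), fun h' => absurd h h'⟩
  · simp only [true_iff]; exact h

/-- When the link set fails, nothing beyond it is inspected; this keeps fields 0 and 2 intact after
a failed trial. -/
theorem determined_trial (t : Option (Set V × Set (Coord G))) :
    Determined (trial (G := G) S Λ U R x b ⁻¹' {t}) (trialSet G S Λ U R x b t) := by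
  intro ω ω' h hω
  have hω : trial S Λ U R x b ω = t := hω
  change trial S Λ U R x b ω' = t
  cases t with
  | none =>
    rw [trial_eq_none] at hω ⊢
    intro h'
    exact hω (determined_link _ ω' ω (fun i hi => (h i hi).symm) h')
  | some t =>
    have h : ∀ i ∈ revealSet G S Λ U R x b t.1, ω i = ω' i := h
    rw [trial_eq_some] at hω ⊢
    refine ⟨determined_link _ ω ω' (fun i hi => h i (Or.inl (Or.inl hi))) hω.1, ?_, ?_⟩
    · exact determined_cluster U b t.1 ω ω' (fun i hi => h i (Or.inl (Or.inr hi))) hω.2.1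
    · rw [← hω.2.2]; exact (openSet_congr h).symm

-- Coordinates of different fields never meet. In field 0 the revealed edges meet C and the alive
-- ones avoid it; in field 1 the distance to x separates them; in field 2 no endpoint of a revealed
-- edge remains unexplored.
open Classical in
theorem disjoint_reveal_alive (C : Set V) :
    Disjoint (revealSet G S Λ U R x b C) (aliveSet G S Λ (U \ C) R (insert x Y)) := by
  refine Set.disjoint_left.2 fun i hi hi' => ?_
  rcases hi with (hi | hi) | hi <;> rcases hi' with (hi' | hi') | hi' <;>
    first
    | exact absurd (hi.1.symm.trans hi'.1) (by decide)
    | skip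
  · obtain ⟨v, hv, hd⟩ := hi'.2.2.2 x (Finset.mem_insert_self _ _)
    exact absurd (hi.2.1 v hv).1 (by omega)
  · obtain ⟨v, hv, hC⟩ := hi.2.2
    exact (hi'.2 v hv).2 hC
  · obtain ⟨v, hv, hvU⟩ := hi'.2.2
    rcases (hi.2.1 v hv).2 with h | h
    · exact hvU.2 h
    · exact h hvU.1

open Classical in
theorem disjoint_link_alive :
    Disjoint (linkSet G S Λ U R x b) (aliveSet G S Λ U R (insert x Y)) := by
  refine Set.disjoint_left.2 fun i hi hi' => ?_
  rcases hi' with (hi' | hi') | hi' <;>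
    first
    | exact absurd (hi.1.symm.trans hi'.1) (by decide)
    | skip
  obtain ⟨v, hv, hd⟩ := hi'.2.2.2 x (Finset.mem_insert_self _ _)
  exact absurd (hi.2.1 v hv).1 (by omega)

open Classical in
theorem alive_subset (C : Set V) :
    aliveSet G S Λ (U \ C) R (insert x Y) ⊆ aliveSet G S Λ U R Y := by
  rintro i ((hi | hi) | hi)
  · exact Or.inl (Or.inl ⟨hi.1, fun v hv => (hi.2 v hv).1⟩)
  · exact Or.inl (Or.inr ⟨hi.1, hi.2.1, hi.2.2.1, fun c hc =>
      hi.2.2.2 c (Finset.mem_insert_of_mem hc)⟩)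
  · obtain ⟨v, hv, hvU⟩ := hi.2.2
    exact Or.inr ⟨hi.1, hi.2.1, v, hv, hvU.1⟩

/-- Link edges lie within R + 1 of x, so centres at mutual distance greater than 2R + 2 never share
a link edge. -/
theorem link_subset_alive (hG : G.Connected) (hx : ∀ c ∈ Y, 2 * R + 2 < G.dist c x) :
    linkSet G S Λ U R x b ⊆ aliveSet G S Λ U R Y := by
  intro i hi
  refine Or.inl (Or.inr ⟨hi.1, fun v hv => (hi.2.1 v hv).2.1, hi.2.2, fun c hc => ?_⟩)
  obtain ⟨v, hv, -⟩ := hi.2.2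
  refine ⟨v, hv, ?_⟩
  have h1 := hx c hc
  have h2 := (hi.2.1 v hv).1
  have h3 : G.dist c x ≤ G.dist c v + G.dist v x := hG.dist_triangle
  rw [G.dist_comm (u := v)] at h3
  omega

theorem reveal_subset_alive (hG : G.Connected) (hx : ∀ c ∈ Y, 2 * R + 2 < G.dist c x) {C : Set V}
    (hC : C ⊆ U) : revealSet G S Λ U R x b C ⊆ aliveSet G S Λ U R Y := by
  rintro i ((hi | hi) | hi)
  · exact link_subset_alive hG hx hi
  · exact Or.inl (Or.inl ⟨hi.1, hi.2.1⟩)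
  · obtain ⟨v, hv, hvC⟩ := hi.2.2
    exact Or.inr ⟨hi.1, fun v hv => (hi.2.1 v hv).1, v, hv, hC hvC⟩

theorem finalGraph_mono {K K' : SimpleGraph V} {A A' : Set (Coord G)} {ω : Coord G → Bool}
    (hK : K' ≤ finalGraph K A ω) (hA : A' ⊆ A) : finalGraph K' A' ω ≤ finalGraph K A ω :=
  sup_le hK ((edgeGraph_mono (openSet_mono hA ω)).trans le_sup_right)

theorem finite_coords [G.LocallyFinite] {Λ : Set V} (hΛ : Λ.Finite) :
    {i : Coord G | ∃ v ∈ (i.1 : Sym2 V), v ∈ Λ}.Finite := by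
  have h : {e : Sym2 V | e ∈ G.edgeSet ∧ ∃ v ∈ e, v ∈ Λ}.Finite := by
    refine (hΛ.biUnion fun x _ =>
      (Set.toFinite (G.neighborSet x)).image fun y => s(x, y)).subset ?_
    rintro e ⟨he, x, hx, hxΛ⟩
    obtain ⟨y, rfl⟩ := hx
    exact Set.mem_biUnion hxΛ ⟨y, he, rfl⟩
  have h2 : {e : G.edgeSet | ∃ v ∈ (e : Sym2 V), v ∈ Λ}.Finite := by
    refine Set.Finite.of_finite_image (f := Subtype.val) (h.subset ?_)
      Subtype.val_injective.injOn
    rintro _ ⟨e, he, rfl⟩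
    exact ⟨e.2, he⟩
  refine ((h2.prod (Set.finite_univ (α := Fin 3)))).subset fun i hi => ⟨hi, trivial⟩

theorem Sym2.exists_mem' (e : Sym2 V) : ∃ v, v ∈ e := by
  induction e with
  | _ a b => exact ⟨a, Sym2.mem_mk_left _ _⟩

theorem finite_aliveSet [G.LocallyFinite] (hΛ : Λ.Finite) (hU : U ⊆ Λ) :
    (aliveSet G S Λ U R Y).Finite := by
  refine (finite_coords hΛ).subset ?_
  rintro i ((hi | hi) | hi)
  · obtain ⟨v, hv⟩ := Sym2.exists_mem' (i.1 : Sym2 V)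
    exact ⟨v, hv, hU (hi.2 v hv)⟩
  · exact hi.2.2.1
  · obtain ⟨v, hv, hvU⟩ := hi.2.2
    exact ⟨v, hv, hU hvU⟩

theorem finite_range_of_determined {ι T : Type*} {τ : (ι → Bool) → T} {I : Set ι} (hI : I.Finite)
    (h : ∀ x y, (∀ i ∈ I, x i = y i) → τ x = τ y) : (Set.range τ).Finite := by
  have := hI.to_subtype
  refine (Set.finite_range fun z : I → Bool => τ (extendFalse I z)).subset ?_
  rintro _ ⟨x, rfl⟩
  exact ⟨restr I x, h _ _ fun i hi => by simp [extendFalse, restr, hi]⟩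

end Trial

/-! ### The open graph after a trial whose link set is open -/

section TrialGraph

variable {V : Type*} {G : SimpleGraph V} {S Λ U : Set V} {R : ℕ} {x y : V}
  {K : SimpleGraph V} {Q : Finset V}

/-- The seed of a trial at the edge `xy`. -/
def seed (G : SimpleGraph V) (U : Set V) (R : ℕ) (x y : V) : Set V :=
  localSet G U R x ∪ localSet G U R y

theorem seed_subset : seed G U R x y ⊆ U := by
  rintro v (h | h) <;> exact (localSet_subset h).1

/-- Every vertex of `C` is connected in `K` to a vertex with a neighbour in `S`, or to an explored
vertex. -/
def Joined (G : SimpleGraph V) (S U C : Set V) (K : SimpleGraph V) : Prop :=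
  ∀ v ∈ C, (∃ w, AdjTo G S w ∧ K.Reachable v w) ∨ ∃ z, z ∉ S ∧ z ∉ U ∧ K.Reachable v z

/-- The near side of `S` is connected in `K'` to the other side. -/
def Linked (G : SimpleGraph V) (S Λ U : Set V) (K K' : SimpleGraph V) : Prop :=
  ∃ w z, AdjTo G S w ∧ w ∉ S ∧ ¬ Far Λ K w ∧ z ∈ otherSide G S Λ U K ∧ K'.Reachable w z

theorem Explored.notMem_of_reachable (h : Explored G S Λ U K Q) {v w : V} (hv : v ∉ S)
    (hr : K.Reachable v w) : w ∉ S := by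
  obtain ⟨p⟩ := hr.symm
  cases p with
  | nil => exact hv
  | cons hadj _ => exact (h.adj _ _ hadj).1

/-- The hypothesis `hOC` is essential in field 0: revealed edges there may leave C inside U, but
those are closed. -/
theorem Explored.adj_next (h : Explored G S Λ U K Q) {C : Set V} (hC : C ⊆ U)
    {O : Set (Coord G)} (hO : O ⊆ revealSet G S Λ U R x (seed G U R x y) C)
    (hb : seed G U R x y ⊆ C)
    (hOC : ∀ i ∈ O, i.2 = 0 → ∀ v ∈ (i.1 : Sym2 V), v ∈ C) (u v : V)
    (huv : (K ⊔ edgeGraph O).Adj u v) : u ∉ S ∧ (u ∉ U ∨ u ∈ C) := by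
  rcases huv with huv | ⟨i, hi, he⟩
  · exact ⟨(h.adj u v huv).1, Or.inl (h.adj u v huv).2⟩
  · have hu : u ∈ (i.1 : Sym2 V) := by rw [he]; exact Sym2.mem_mk_left _ _
    rcases hO hi with (h' | h') | h'
    · exact ⟨(h'.2.1 u hu).2.1, (h'.2.1 u hu).2.2.elim (fun h => Or.inr (hb h)) Or.inl⟩
    · have := hOC i hi h'.1 u hu
      exact ⟨h.notMem _ (hC this), Or.inr this⟩
    · exact ⟨(h'.2.1 u hu).1, (h'.2.1 u hu).2.symm⟩

theorem openSet_reveal_mem_cluster {b : Set V} {ω : Coord G → Bool} {i : Coord G}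
    (hi : i ∈ openSet (revealSet G S Λ U R x b (cluster U b ω)) ω) (h0 : i.2 = 0) :
    ∀ v ∈ (i.1 : Sym2 V), v ∈ cluster U b ω := by
  rcases hi.1 with (h | h) | h
  · exact absurd (h.1.symm.trans h0) (by decide)
  · obtain ⟨u, hu, huC⟩ := h.2.2
    intro v hv
    obtain ⟨w, hw⟩ := hu
    rw [hw, Sym2.mem_iff] at hv
    rcases hv with rfl | rfl
    · exact huC
    · exact mem_cluster_step ⟨h.1, h.2.1⟩ huC hi.2 hw
  · exact absurd (h.1.symm.trans h0) (by decide)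

variable {ω : Coord G → Bool}

/-- The graph of known open edges after a successful revelation of the link set. -/
def nextGraph (S Λ U : Set V) (R : ℕ) (x y : V) (K : SimpleGraph V) (ω : Coord G → Bool) :
    SimpleGraph V :=
  K ⊔ edgeGraph (openSet (revealSet G S Λ U R x (seed G U R x y)
    (cluster U (seed G U R x y) ω)) ω)

theorem nextGraph_adj_of_link
    (hW : ∀ i ∈ linkSet G S Λ U R x (seed G U R x y), ω i = true) {u v : V} (huv : G.Adj u v)
    (hu : G.dist x u ≤ R + 1 ∧ u ∉ S ∧ (u ∈ seed G U R x y ∨ u ∉ U))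
    (hv : G.dist x v ≤ R + 1 ∧ v ∉ S ∧ (v ∈ seed G U R x y ∨ v ∉ U)) (hΛ : u ∈ Λ ∨ v ∈ Λ) :
    (nextGraph S Λ U R x y K ω).Adj u v := by
  right
  have : coord huv 1 ∈ linkSet G S Λ U R x (seed G U R x y) := by
    refine ⟨rfl, fun w hw => ?_, ?_⟩
    · rcases Sym2.mem_iff.1 hw with rfl | rfl
      exacts [hu, hv]
    · rcases hΛ with h | h
      exacts [⟨u, Sym2.mem_mk_left _ _, h⟩, ⟨v, Sym2.mem_mk_right _ _, h⟩]
  exact ⟨coord huv 1, ⟨Or.inl (Or.inl this), hW _ this⟩, rfl⟩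

theorem dist_le_of_mem_seed (hG : G.Connected) (hxy : G.Adj x y) {v : V}
    (hv : v ∈ seed G U R x y) : G.dist x v ≤ R + 1 := by
  rcases hv with h | h
  · have := (localSet_subset h).2; omega
  · have h1 := (localSet_subset h).2
    have h2 : G.dist x v ≤ G.dist x y + G.dist y v := hG.dist_triangle
    have h3 : G.dist x y = 1 := SimpleGraph.dist_eq_one_iff_adj.2 hxy
    omega

theorem mem_seed_or (w : V) (hw : w = x ∨ w = y) : w ∈ seed G U R x y ∨ w ∉ U := by
  by_cases h : w ∈ U
  · left
    rcases hw with rfl | rfl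
    exacts [Or.inl (mem_localSet_self h), Or.inr (mem_localSet_self h)]
  · exact Or.inr h

theorem nextGraph_adj_xy (hxy : G.Adj x y)
    (hxS : x ∉ S) (hyS : y ∉ S) (hxΛ : x ∈ Λ)
    (hW : ∀ i ∈ linkSet G S Λ U R x (seed G U R x y), ω i = true) : (nextGraph S Λ U R x y K ω).Adj x y := by
  refine nextGraph_adj_of_link hW hxy ⟨by simp, hxS, mem_seed_or x (Or.inl rfl)⟩
    ⟨?_, hyS, mem_seed_or y (Or.inr rfl)⟩ (Or.inl hxΛ)
  rw [SimpleGraph.dist_eq_one_iff_adj.2 hxy]; omega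


/-- The link set contains xy and every edge of G that joins consecutive vertices of a local
component, so the whole seed is tied to x. The rest of the cluster hangs on the seed by revealed
open field-0 edges. -/
theorem nextGraph_reachable_of_mem_cluster (hG : G.Connected) (hE : Explored G S Λ U K Q) (hxy : G.Adj x y)
    (hxS : x ∉ S) (hyS : y ∉ S) (hxΛ : x ∈ Λ)
    (hW : ∀ i ∈ linkSet G S Λ U R x (seed G U R x y), ω i = true) {v : V}
    (hv : v ∈ cluster U (seed G U R x y) ω) : (nextGraph S Λ U R x y K ω).Reachable v x := by
  have hseed : ∀ v ∈ seed G U R x y, G.dist x v ≤ R + 1 ∧ v ∉ S ∧ (v ∈ seed G U R x y ∨ v ∉ U) :=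
    fun v hv => ⟨dist_le_of_mem_seed hG hxy hv, hE.notMem v (seed_subset hv), Or.inl hv⟩
  refine cluster_induction (P := fun v => (nextGraph S Λ U R x y K ω).Reachable v x) ?_ ?_ v hv
  · rintro v (hv | hv)
    · revert v
      refine localSet_induction (fun _ => SimpleGraph.Reachable.refl _) ?_
      intro u v hu hv huv hr
      exact (SimpleGraph.Adj.reachable (nextGraph_adj_of_link hW huv.symm (hseed v (Or.inl hv))
        (hseed u (Or.inl hu)) (Or.inl (hE.subset (localSet_subset hv).1)))).trans hr
    · revert v
      refine localSet_induction
        (fun _ => (nextGraph_adj_xy hxy hxS hyS hxΛ hW).symm.reachable) ?_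
      intro u v hu hv huv hr
      exact (SimpleGraph.Adj.reachable (nextGraph_adj_of_link hW huv.symm (hseed v (Or.inr hv))
        (hseed u (Or.inr hu)) (Or.inl (hE.subset (localSet_subset hv).1)))).trans hr
  · intro u v i hi hu hω he hr
    refine (SimpleGraph.Adj.reachable (G := nextGraph S Λ U R x y K ω) (Or.inr ⟨i, ?_, ?_⟩)).trans hr
    · exact ⟨Or.inl (Or.inr ⟨hi.1, hi.2, u, by rw [he]; exact Sym2.mem_mk_left _ _, hu⟩), hω⟩
    · rw [he]; exact Sym2.eq_swap


theorem nextGraph_adj_of_open (hE : Explored G S Λ U K Q) {u z : V} (hu : u ∈ cluster U (seed G U R x y) ω) (hzS : z ∉ S)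
    (hzU : z ∉ U) (huz : G.Adj u z) (hω : ω (coord huz 2) = true) :
    (nextGraph S Λ U R x y K ω).Adj u z := by
  refine Or.inr ⟨coord huz 2, ⟨Or.inr ⟨rfl, fun w hw => ?_, u, Sym2.mem_mk_left _ _, hu⟩, hω⟩, rfl⟩
  rcases Sym2.mem_iff.1 hw with rfl | rfl
  · exact ⟨hE.notMem _ (cluster_subset seed_subset hu), Or.inl hu⟩
  · exact ⟨hzS, Or.inr hzU⟩


/-- The cluster and the edge xy form one connected piece through x, so contact with both sides links
them. Either contact may also be immediate, when x or y is itself an explored vertex of the required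
side. -/
theorem joined_and_linked (hG : G.Connected) (hE : Explored G S Λ U K Q) (hxy : G.Adj x y)
    (hxS : x ∉ S) (hyS : y ∉ S) (hxΛ : x ∈ Λ)
    (hW : ∀ i ∈ linkSet G S Λ U R x (seed G U R x y), ω i = true)
    (hx : x ∈ nearSide G S Λ U K ∨ (∃ v ∈ cluster U (seed G U R x y) ω, AdjTo G S v) ∨
      ∃ v ∈ cluster U (seed G U R x y) ω, ∃ z ∈ nearSide G S Λ U K, ∃ h : G.Adj v z,
        ω (coord h 2) = true)
    (hy : y ∈ otherSide G S Λ U K ∨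
      ∃ v ∈ cluster U (seed G U R x y) ω, ∃ z ∈ otherSide G S Λ U K, ∃ h : G.Adj v z,
        ω (coord h 2) = true) :
    Joined G S U (cluster U (seed G U R x y) ω) (nextGraph S Λ U R x y K ω) ∧
      Linked G S Λ U K (nextGraph S Λ U R x y K ω) := by
  set K' := nextGraph S Λ U R x y K ω with hK'
  have hKK' : K ≤ K' := le_sup_left
  have hr := fun {v} (hv : v ∈ cluster U (seed G U R x y) ω) =>
    nextGraph_reachable_of_mem_cluster hG hE hxy hxS hyS hxΛ hW hv
  have hy' : ∃ z ∈ otherSide G S Λ U K, K'.Reachable x z := by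
    rcases hy with hy | ⟨v, hv, z, hz, h, hω⟩
    · exact ⟨y, hy, (nextGraph_adj_xy hxy hxS hyS hxΛ hW).reachable⟩
    · exact ⟨z, hz, (hr hv).symm.trans
        (nextGraph_adj_of_open hE hv hz.1 hz.2.1 h hω).reachable⟩
  have hnear : ∀ z ∈ nearSide G S Λ U K,
      ∃ w, AdjTo G S w ∧ w ∉ S ∧ ¬ Far Λ K w ∧ K'.Reachable w z := by
    rintro z ⟨hzS, hzU, hzf, w, hw, hzw⟩
    refine ⟨w, hw, hE.notMem_of_reachable hzS hzw, ?_, (hzw.mono hKK').symm⟩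
    rintro ⟨w', hw', hr'⟩
    exact hzf ⟨w', hw', hzw.trans hr'⟩
  have hx' : ∃ w, AdjTo G S w ∧ w ∉ S ∧ ¬ Far Λ K w ∧ K'.Reachable w x := by
    rcases hx with hx | ⟨v, hv, hvS⟩ | ⟨v, hv, z, hz, h, hω⟩
    · exact hnear x hx
    · have hvU := cluster_subset seed_subset hv
      exact ⟨v, hvS, hE.notMem v hvU, hE.not_far hvU, hr hv⟩
    · obtain ⟨w, h1, h2, h3, h4⟩ := hnear z hz
      exact ⟨w, h1, h2, h3, h4.trans
        ((nextGraph_adj_of_open hE hv hz.1 hz.2.1 h hω).symm.reachable.trans (hr hv))⟩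
  obtain ⟨z, hz, hxz⟩ := hy'
  obtain ⟨w, h1, h2, h3, h4⟩ := hx'
  exact ⟨fun v hv => Or.inr ⟨z, hz.1, hz.2.1, (hr hv).trans hxz⟩,
    w, z, h1, h2, h3, hz, h4.trans hxz⟩


/-- If the cluster is isolated, nothing reachable from x is explored or adjacent to S. An exit from
U within the ball around x would be such a contact, through a link edge or adjacency to S; hence the
seed contains the whole ball, which is what makes `FewOutBound` applicable. -/
theorem of_not_joined (hG : G.Connected) (hE : Explored G S Λ U K Q) (hxy : G.Adj x y)
    (hxS : x ∉ S) (hyS : y ∉ S) (hxΛ : x ∈ Λ)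
    (hW : ∀ i ∈ linkSet G S Λ U R x (seed G U R x y), ω i = true)
    (hJ : ¬ Joined G S U (cluster U (seed G U R x y) ω) (nextGraph S Λ U R x y K ω)) :
    (x ∈ U ∧ ∀ v, G.dist x v ≤ R → v ∈ localSet G U R x) ∧
      ∀ v ∈ cluster U (seed G U R x y) ω, ∀ z, z ∉ U → ∀ h : G.Adj v z,
        z ∉ S ∧ ω (coord h 2) = false := by
  set K' := nextGraph S Λ U R x y K ω with hK'
  have hr := fun {v} (hv : v ∈ cluster U (seed G U R x y) ω) =>
    nextGraph_reachable_of_mem_cluster hG hE hxy hxS hyS hxΛ hW hv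
  have hadj : ∀ v, K'.Reachable x v → ¬ AdjTo G S v := by
    intro v hv hS
    exact hJ fun u hu => Or.inl ⟨v, hS, (hr hu).trans hv⟩
  have hX : ∀ z, K'.Reachable x z → z ∉ S → z ∈ U := by
    intro z hz hS
    by_contra hU
    exact hJ fun u hu => Or.inr ⟨z, hS, hU, (hr hu).trans hz⟩
  have hxU : x ∈ U := hX x (SimpleGraph.Reachable.refl _) hxS
  refine ⟨⟨hxU, fun v hv => ?_⟩, fun v hv z hz h => ?_⟩
  · rcases mem_localSet_or_exit hG hxU v hv with h | ⟨u, u', hu, hu', huu', hd⟩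
    · exact h
    · exfalso
      have hus : u ∈ seed G U R x y := Or.inl hu
      have hxu := (hr (subset_cluster hus)).symm
      by_cases hS : u' ∈ S
      · exact hadj u hxu ⟨u', hS, huu'.symm⟩
      · refine hu' (hX u' (hxu.trans (SimpleGraph.Adj.reachable ?_)) hS)
        exact nextGraph_adj_of_link hW huu'
          ⟨dist_le_of_mem_seed hG hxy hus, hE.notMem u (seed_subset hus), Or.inl hus⟩
          ⟨by omega, hS, Or.inr hu'⟩ (Or.inl (hE.subset (seed_subset hus)))
  · have hzS : z ∉ S := fun hS => hadj v (hr hv).symm ⟨z, hS, h.symm⟩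
    refine ⟨hzS, ?_⟩
    by_contra hω
    rw [Bool.not_eq_false] at hω
    exact hz (hX z ((hr hv).symm.trans
      (nextGraph_adj_of_open hE hv hzS hz h hω).reachable) hzS)

end TrialGraph

/-! ### Field-0 clusters and their exits from the unexplored region -/

section TrialProbability

variable {V : Type*} {G : SimpleGraph V}

/-- Parameter `p` for the first field and `s` for the two others. -/
noncomputable def fieldParam (G : SimpleGraph V) (p s : unitInterval) : Coord G → unitInterval :=
  fun i => if i.2 = 0 then p else s

/-- The law of the three fields. -/
noncomputable abbrev fieldMeasure (G : SimpleGraph V) (p s : unitInterval) :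
    Measure (Coord G → Bool) := bernProd (fieldParam G p s)

theorem bernProd_forall_true {ι : Type*} (a : ι → unitInterval) {F : Set ι} (hF : F.Finite)
    (c : unitInterval) (ha : ∀ i ∈ F, a i = c) :
    (bernProd a).real {ω | ∀ i ∈ F, ω i = true} = (c : ℝ) ^ F.ncard := by
  have h := bernProd_all a hF.toFinset (fun _ => true)
  simp only [Set.Finite.mem_toFinset, if_true] at h
  rw [h, Finset.prod_congr rfl (g := fun _ => (c : ℝ))
    (fun i hi => by rw [ha i (by simpa using hi)]), Finset.prod_const,
    Set.ncard_eq_toFinset_card F hF]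

theorem bernProd_forall_false {ι : Type*} (a : ι → unitInterval) {F : Set ι} (hF : F.Finite)
    (c : unitInterval) (ha : ∀ i ∈ F, a i = c) :
    (bernProd a).real {ω | ∀ i ∈ F, ω i = false} = (1 - (c : ℝ)) ^ F.ncard := by
  have h := bernProd_all a hF.toFinset (fun _ => false)
  simp only [Set.Finite.mem_toFinset, Bool.false_eq_true, if_false] at h
  rw [h, Finset.prod_congr rfl (g := fun _ => 1 - (c : ℝ))
    (fun i hi => by rw [ha i (by simpa using hi)]), Finset.prod_const,
    Set.ncard_eq_toFinset_card F hF]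

theorem determined_closed {ι : Type*} (L : Set ι) :
    Determined {ω : ι → Bool | ∀ i ∈ L, ω i = false} L :=
  fun x y hxy hx i hi => by rw [← hxy i hi]; exact hx i hi

variable {p s : unitInterval} {U b : Set V}

theorem finite_inner [G.LocallyFinite] (hU : U.Finite) : (inner G U).Finite :=
  (finite_coords hU).subset fun i hi => by
    obtain ⟨v, hv⟩ := Sym2.exists_mem' (i.1 : Sym2 V)
    exact ⟨v, hv, hi.2 v hv⟩

theorem innerTouching_subset (C : Set V) : innerTouching G U C ⊆ inner G U :=
  fun _ hi => ⟨hi.1, hi.2.1⟩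

theorem finite_range_cluster [G.LocallyFinite] (hU : U.Finite) :
    (Set.range (cluster (G := G) U b)).Finite :=
  finite_range_of_determined (finite_inner hU) fun _ _ h => cluster_congr h

open Classical in
theorem cluster_event_eq [G.LocallyFinite] (hU : U.Finite) (P : Set V → Prop) (D : Set V → Set (Coord G → Bool))
    (J : Set V → Set (Coord G)) (hD : ∀ C, P C → Determined (D C) (J C))
    (hJ : ∀ C, P C → Disjoint (innerTouching G U C) (J C)) (hfin : ∀ C, P C → (J C).Finite) :
    (fieldMeasure G p s).real {ω | P (cluster U b ω) ∧ ω ∈ D (cluster U b ω)} =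
      ∑ C ∈ (finite_range_cluster (b := b) (G := G) hU).toFinset,
        if P C then (fieldMeasure G p s).real (cluster U b ⁻¹' {C}) *
          (fieldMeasure G p s).real (D C) else 0 := by
  have := measureReal_eq_sum_fibers (fieldParam G p s) (cluster U b)
    (fun C => if P C then D C else ∅) (fun C => innerTouching G U C)
    (fun C => if P C then J C else ∅)
    (finite_range_cluster (b := b) (G := G) hU).toFinset (by simp)
    (fun C _ => determined_cluster U b C) ?_ ?_ ?_ ?_
  · have h : {ω | P (cluster U b ω) ∧ ω ∈ D (cluster U b ω)} =
        {ω | ω ∈ (fun C => if P C then D C else ∅) (cluster U b ω)} := by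
      ext ω
      by_cases h : P (cluster U b ω) <;> simp [h]
    rw [h, this]
    refine Finset.sum_congr rfl fun C _ => ?_
    by_cases h : P C <;> simp [h]
  · intro C _
    by_cases h : P C
    · simpa [h] using hD C h
    · simp only [h, if_false]; exact fun _ _ _ h => h
  · intro C _
    by_cases h : P C
    · simpa [h] using hJ C h
    · simp [h]
  · intro C _
    exact (finite_inner hU).subset (innerTouching_subset C)
  · intro C _
    by_cases h : P C
    · simpa [h] using hfin C h
    · simp [h]

open Classical in
theorem cluster_prob_eq [G.LocallyFinite] (hU : U.Finite) (P : Set V → Prop) :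
    (fieldMeasure G p s).real {ω | P (cluster U b ω)} =
      ∑ C ∈ (finite_range_cluster (b := b) (G := G) hU).toFinset,
        if P C then (fieldMeasure G p s).real (cluster U b ⁻¹' {C}) else 0 :=
  measureReal_preimage_eq_sum (fieldParam G p s) (cluster U b) (fun C => innerTouching G U C) _
    (by simp) (fun C _ => determined_cluster U b C)
    (fun C _ => (finite_inner hU).subset (innerTouching_subset C)) P

/-- Given that the cluster equals C, the coordinates J C are still fresh, so D C keeps its
unconditional probability; sum over C. -/
theorem le_cluster_event [G.LocallyFinite] (hU : U.Finite) (P : Set V → Prop) (D : Set V → Set (Coord G → Bool))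
    (J : Set V → Set (Coord G)) (hD : ∀ C, P C → Determined (D C) (J C))
    (hJ : ∀ C, P C → Disjoint (innerTouching G U C) (J C)) (hfin : ∀ C, P C → (J C).Finite)
    {c : ℝ} (hc : ∀ C, P C → c ≤ (fieldMeasure G p s).real (D C)) :
    c * (fieldMeasure G p s).real {ω | P (cluster U b ω)} ≤
      (fieldMeasure G p s).real {ω | P (cluster U b ω) ∧ ω ∈ D (cluster U b ω)} := by
  classical
  rw [cluster_event_eq hU P D J hD hJ hfin, cluster_prob_eq hU P, Finset.mul_sum]
  refine Finset.sum_le_sum fun C _ => ?_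
  by_cases h : P C
  · simp only [h, if_true]
    rw [mul_comm]
    exact mul_le_mul_of_nonneg_left (hc C h) measureReal_nonneg
  · simp [h]

theorem cluster_event_le [G.LocallyFinite] (hU : U.Finite) (P : Set V → Prop) (D : Set V → Set (Coord G → Bool))
    (J : Set V → Set (Coord G)) (hD : ∀ C, P C → Determined (D C) (J C))
    (hJ : ∀ C, P C → Disjoint (innerTouching G U C) (J C)) (hfin : ∀ C, P C → (J C).Finite)
    {c : ℝ} (hc0 : 0 ≤ c) (hc : ∀ C, P C → (fieldMeasure G p s).real (D C) ≤ c) :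
    (fieldMeasure G p s).real {ω | P (cluster U b ω) ∧ ω ∈ D (cluster U b ω)} ≤ c := by
  classical
  have h1 : (fieldMeasure G p s).real {ω | P (cluster U b ω) ∧ ω ∈ D (cluster U b ω)} ≤
      c * (fieldMeasure G p s).real {ω | P (cluster U b ω)} := by
    rw [cluster_event_eq hU P D J hD hJ hfin, cluster_prob_eq hU P, Finset.mul_sum]
    refine Finset.sum_le_sum fun C _ => ?_
    by_cases h : P C
    · simp only [h, if_true]
      rw [mul_comm]
      exact mul_le_mul_of_nonneg_right (hc C h) measureReal_nonneg
    · simp [h]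
  exact h1.trans (mul_le_of_le_one_right hc0 measureReal_le_one)

/-- The edges between `C` and the complement of `U`. -/
def outEdges (G : SimpleGraph V) (U C : Set V) : Set G.edgeSet :=
  {e | (∃ v ∈ (e : Sym2 V), v ∈ C) ∧ ∃ z ∈ (e : Sym2 V), z ∉ U}

/-- The copy of a set of edges in the field `k`. -/
def inField (k : Fin 3) (F : Set G.edgeSet) : Set (Coord G) := (fun e => (e, k)) '' F

theorem ncard_inField (k : Fin 3) (F : Set G.edgeSet) : (inField k F).ncard = F.ncard :=
  Set.ncard_image_of_injective _ fun _ _ h => (Prod.ext_iff.1 h).1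

theorem finite_outEdges [G.LocallyFinite] {C : Set V} (hC : C.Finite) : (outEdges G U C).Finite := by
  have := (finite_coords (G := G) hC).image Prod.fst
  refine this.subset fun e he => ⟨(e, 0), he.1, rfl⟩

theorem finite_inField [G.LocallyFinite] {C : Set V} (hC : C.Finite) (k : Fin 3) :
    (inField k (outEdges G U C)).Finite := (finite_outEdges hC).image _

/-- The vertices connected to `b` by edges that are open in the first field. -/
def fullCluster (b : Set V) (ω : Coord G → Bool) : Set V :=
  {v | ∃ u ∈ b, (edgeGraph (openSet {i | i.2 = 0} ω)).Reachable u v}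

/-- An open path leaving the cluster computed inside U would have to use one of its edges to the
complement of U. -/
theorem fullCluster_subset_cluster {ω : Coord G → Bool} (hb : b ⊆ U)
    (h : ∀ i ∈ inField 0 (outEdges G U (cluster U b ω)), ω i = false) :
    fullCluster b ω ⊆ cluster U b ω := by
  rintro v ⟨u, hu, hr⟩
  rw [SimpleGraph.reachable_iff_reflTransGen] at hr
  induction hr with
  | refl => exact subset_cluster hu
  | @tail u' v' _ h2 ih =>
    obtain ⟨i, hi, he⟩ := h2
    have hu' : u' ∈ (i.1 : Sym2 V) := by rw [he]; exact Sym2.mem_mk_left _ _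
    have hv' : v' ∈ (i.1 : Sym2 V) := by rw [he]; exact Sym2.mem_mk_right _ _
    by_cases hvU : v' ∈ U
    · refine mem_cluster_step ⟨hi.1, fun w hw => ?_⟩ ih hi.2 he
      rw [he, Sym2.mem_iff] at hw
      rcases hw with rfl | rfl
      exacts [cluster_subset hb ih, hvU]
    · exfalso
      have hi0 : i.2 = 0 := hi.1
      have := h i ⟨i.1, ⟨⟨u', hu', ih⟩, v', hv', hvU⟩, Prod.ext rfl hi0.symm⟩
      rw [hi.2] at this
      cases this

/-- Given the cluster inside U, its exits are independent of it. Fewer than r of them are all closed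
with probability at least (1 - p)^r, and then the full cluster of b is finite. -/
theorem measureReal_outEdges_lt [G.LocallyFinite] (hU : U.Finite) (hb : b ⊆ U) (r : ℕ) {δ : ℝ}
    (hδ : (fieldMeasure G p s).real {ω | ¬ (fullCluster b ω).Infinite} ≤ δ) :
    (1 - (p : ℝ)) ^ r * (fieldMeasure G p s).real
      {ω | (outEdges G U (cluster U b ω)).ncard < r} ≤ δ := by
  have h1 := le_cluster_event (G := G) (p := p) (s := s) (b := b) hU
    (fun C => C ⊆ U ∧ (outEdges G U C).ncard < r)
    (fun C => {ω | ∀ i ∈ inField 0 (outEdges G U C), ω i = false})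
    (fun C => inField 0 (outEdges G U C)) (fun C _ => determined_closed _) ?_ ?_
    (c := (1 - (p : ℝ)) ^ r) ?_
  · have h2 : {ω : Coord G → Bool | cluster U b ω ⊆ U ∧ (outEdges G U (cluster U b ω)).ncard < r} =
        {ω | (outEdges G U (cluster U b ω)).ncard < r} := by
      ext ω
      exact and_iff_right (cluster_subset hb)
    rw [h2] at h1
    refine h1.trans ((measureReal_mono ?_).trans hδ)
    rintro ω ⟨-, hω⟩ hinf
    exact hinf (hU.subset ((fullCluster_subset_cluster hb hω).trans (cluster_subset hb)))
  · rintro C -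
    refine Set.disjoint_left.2 ?_
    rintro i hi ⟨e, he, rfl⟩
    obtain ⟨z, hz, hzU⟩ := he.2
    exact hzU (hi.2.1 z hz)
  · rintro C ⟨hC, -⟩
    exact finite_inField (hU.subset hC) 0
  · rintro C ⟨hC, hr⟩
    rw [bernProd_forall_false _ (finite_inField (hU.subset hC) 0) p, ncard_inField]
    · exact pow_le_pow_of_le_one (sub_nonneg.2 p.2.2) (sub_le_self _ p.2.1) hr.le
    · rintro _ ⟨e, _, rfl⟩
      simp [fieldParam]

variable {S Λ : Set V} {R r : ℕ} {x y : V} {K : SimpleGraph V} {Q : Finset V} {η : ℝ}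

/-- `C` contains a vertex adjacent to `S` or to the near side. -/
def HitsNear (G : SimpleGraph V) (S Λ U : Set V) (K : SimpleGraph V) (C : Set V) : Prop :=
  ∃ v ∈ C, AdjTo G S v ∨ ∃ z ∈ nearSide G S Λ U K, G.Adj v z

/-- `C` contains a vertex adjacent to the other side. -/
def HitsOther (G : SimpleGraph V) (S Λ U : Set V) (K : SimpleGraph V) (C : Set V) : Prop :=
  ∃ v ∈ C, ∃ z ∈ otherSide G S Λ U K, G.Adj v z

theorem HitsNear.mono {C C' : Set V} (h : HitsNear G S Λ U K C) (hC : C ⊆ C') :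
    HitsNear G S Λ U K C' := let ⟨v, hv, h⟩ := h; ⟨v, hC hv, h⟩

theorem HitsOther.mono {C C' : Set V} (h : HitsOther G S Λ U K C) (hC : C ⊆ C') :
    HitsOther G S Λ U K C' := let ⟨v, hv, h⟩ := h; ⟨v, hC hv, h⟩

theorem hits_of_adj {C : Set V} {v z : V} (hv : v ∈ C) (hz : z ∉ U) (h : G.Adj v z) :
    HitsNear G S Λ U K C ∨ HitsOther G S Λ U K C := by
  by_cases hzS : z ∈ S
  · exact Or.inl ⟨v, hv, Or.inl ⟨z, hzS, h.symm⟩⟩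
  · by_cases hn : z ∈ nearSide G S Λ U K
    · exact Or.inl ⟨v, hv, Or.inr ⟨z, hn, h⟩⟩
    · exact Or.inr ⟨v, hv, z, ⟨hzS, hz, hn⟩, h⟩

/-- The probability that the cluster of a set containing a ball of radius `R` has few outgoing
edges is at most `η`. -/
def FewOutBound (G : SimpleGraph V) (p s : unitInterval) (R r : ℕ) (η : ℝ) : Prop :=
  ∀ (U b : Set V) (w : V), U.Finite → b ⊆ U → (∀ v, G.dist w v ≤ R → v ∈ b) →
    (fieldMeasure G p s).real {ω | (outEdges G U (cluster U b ω)).ncard < r} ≤ η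

/-- Any contact with the complement of U is a contact with one of the two sides, adjacency to S
counting as near. Such a contact is certain if the local component exits U within the ball;
otherwise the component contains the ball, and its cluster has an exit with probability at least 1 -
η. -/
theorem hit_prob [G.LocallyFinite] (hG : G.Connected) (hU : U.Finite) (hη : FewOutBound G p s R r η) (hr : 0 < r)
    (h4 : η ≤ 1 / 4) {w : V} (hw : w ∈ U) :
    3 / 4 ≤ (fieldMeasure G p s).real {ω | HitsNear G S Λ U K (cluster U (localSet G U R w) ω)} +
      (fieldMeasure G p s).real {ω | HitsOther G S Λ U K (cluster U (localSet G U R w) ω)} := by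
  set A := {ω : Coord G → Bool | HitsNear G S Λ U K (cluster U (localSet G U R w) ω)}
  set B := {ω : Coord G → Bool | HitsOther G S Λ U K (cluster U (localSet G U R w) ω)}
  refine le_trans ?_ (measureReal_union_le (μ := fieldMeasure G p s) A B)
  by_cases hex : ∃ u u', u ∈ localSet G U R w ∧ u' ∉ U ∧ G.Adj u u' ∧ G.dist w u' ≤ R
  · obtain ⟨u, u', hu, hu', huu', -⟩ := hex
    have : A ∪ B = Set.univ := Set.eq_univ_of_forall fun ω =>
      hits_of_adj (subset_cluster hu) hu' huu'
    rw [this, probReal_univ]; norm_num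
  · have hball : ∀ v, G.dist w v ≤ R → v ∈ localSet G U R w := fun v hv =>
      (mem_localSet_or_exit hG hw v hv).resolve_right hex
    have h1 := hη U _ w hU (fun v hv => (localSet_subset hv).1) hball
    have h2 : (Set.univ : Set (Coord G → Bool)) ⊆
        {ω | (outEdges G U (cluster U (localSet G U R w) ω)).ncard < r} ∪ (A ∪ B) := by
      intro ω _
      by_cases h : outEdges G U (cluster U (localSet G U R w) ω) = ∅
      · left
        show Set.ncard _ < r
        rw [h]; simpa using hr
      · right
        obtain ⟨e, ⟨v, hve, hv⟩, z, hze, hz⟩ := Set.nonempty_iff_ne_empty.2 h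
        have hvz : v ≠ z := fun hvz => hz (hvz ▸
          cluster_subset (fun v hv => (localSet_subset hv).1) hv)
        have he : (e : Sym2 V) = s(v, z) := ((Sym2.mem_and_mem_iff hvz).1 ⟨hve, hze⟩)
        exact hits_of_adj hv hz (by have := e.2; rwa [he] at this)
    have h3 := (measureReal_mono (μ := fieldMeasure G p s) h2).trans (measureReal_union_le _ _)
    rw [probReal_univ] at h3
    linarith

end TrialProbability

/-! ### Probabilities of linking the two sides and of creating a pending cluster -/

section SuccessProbability

variable {V : Type*} {G : SimpleGraph V} {p s : unitInterval} {S Λ U : Set V} {R r : ℕ} {x y : V}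
  {K : SimpleGraph V} {Q : Finset V} {η : ℝ}

theorem finite_linkSet [G.LocallyFinite] (hΛ : Λ.Finite) (b : Set V) :
    (linkSet G S Λ U R x b).Finite :=
  (finite_coords hΛ).subset fun _ hi => hi.2.2

theorem linkSet_prob [G.LocallyFinite] (hΛ : Λ.Finite) (b : Set V) :
    (fieldMeasure G p s).real {ω | ∀ i ∈ linkSet G S Λ U R x b, ω i = true} =
      (s : ℝ) ^ (linkSet G S Λ U R x b).ncard :=
  bernProd_forall_true _ (finite_linkSet hΛ b) s fun i hi => by simp [fieldParam, hi.1]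

theorem isUpperSet_cluster {P : Set V → Prop} (hP : ∀ C C', P C → C ⊆ C' → P C') (b : Set V) :
    IsUpperSet {ω : Coord G → Bool | P (cluster U b ω)} :=
  fun _ _ h hω => hP _ _ hω (cluster_mono le_rfl h)

theorem determined_cluster_event (P : Set V → Prop) (b : Set V) :
    Determined {ω : Coord G → Bool | P (cluster U b ω)} (inner G U) := by
  intro ω ω' h hω
  change P _
  rw [← cluster_congr h]
  exact hω

/-- The seed meets both sides with probability at least `1 / 8`. -/
theorem hits_both_prob [G.LocallyFinite] (hG : G.Connected) (hU : U.Finite)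
    (hη : FewOutBound G p s R r η) (hr : 0 < r) (h4 : η ≤ 1 / 4)
    (hx : x ∈ nearSide G S Λ U K ∨ x ∈ U ∧ 1 / 4 ≤ (fieldMeasure G p s).real
      {ω | HitsNear G S Λ U K (cluster U (localSet G U R x) ω)})
    (hy : y ∈ otherSide G S Λ U K ∨ y ∈ U ∧ (fieldMeasure G p s).real
      {ω | HitsNear G S Λ U K (cluster U (localSet G U R y) ω)} < 1 / 4) :
    1 / 8 ≤ (fieldMeasure G p s).real {ω |
      (x ∈ nearSide G S Λ U K ∨ HitsNear G S Λ U K (cluster U (seed G U R x y) ω)) ∧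
      (y ∈ otherSide G S Λ U K ∨ HitsOther G S Λ U K (cluster U (seed G U R x y) ω))} := by
  set A := {ω : Coord G → Bool |
    x ∈ nearSide G S Λ U K ∨ HitsNear G S Λ U K (cluster U (localSet G U R x) ω)} with hA
  set B := {ω : Coord G → Bool |
    y ∈ otherSide G S Λ U K ∨ HitsOther G S Λ U K (cluster U (localSet G U R y) ω)} with hB
  have h := harris (fieldParam G p s) (A := A) (B := B) (finite_inner hU)
    (determined_cluster_event (fun C => x ∈ nearSide G S Λ U K ∨ HitsNear G S Λ U K C) _)
    (determined_cluster_event (fun C => y ∈ otherSide G S Λ U K ∨ HitsOther G S Λ U K C) _)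
    (isUpperSet_cluster (P := fun C => x ∈ nearSide G S Λ U K ∨ HitsNear G S Λ U K C)
      (fun C C' h hC => h.imp_right fun h => h.mono hC) _)
    (isUpperSet_cluster (P := fun C => y ∈ otherSide G S Λ U K ∨ HitsOther G S Λ U K C)
      (fun C C' h hC => h.imp_right fun h => h.mono hC) _)
  have h1 : 1 / 4 ≤ (fieldMeasure G p s).real A := by
    rcases hx with hx | ⟨-, hx⟩
    · have : A = Set.univ := Set.eq_univ_of_forall fun ω => Or.inl hx
      rw [this, probReal_univ]; norm_num
    · exact hx.trans (measureReal_mono fun ω hω => Or.inr hω)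
  -- If y is unexplored, reaching the near side has probability below 1/4, so of the 3/4 in
  -- `hit_prob` at least 1/2 is left for the other side.
  have h2 : 1 / 2 ≤ (fieldMeasure G p s).real B := by
    rcases hy with hy | ⟨hyU, hy⟩
    · have : B = Set.univ := Set.eq_univ_of_forall fun ω => Or.inl hy
      rw [this, probReal_univ]; norm_num
    · have h3 := hit_prob (S := S) (Λ := Λ) (K := K) hG hU hη hr h4 hyU
      have h4 : (fieldMeasure G p s).real
          {ω | HitsOther G S Λ U K (cluster U (localSet G U R y) ω)} ≤
          (fieldMeasure G p s).real B := measureReal_mono fun ω hω => Or.inr hω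
      linarith
  have h3 : (1 : ℝ) / 8 ≤ (fieldMeasure G p s).real A * (fieldMeasure G p s).real B := by
    calc (1 : ℝ) / 8 = 1 / 4 * (1 / 2) := by norm_num
      _ ≤ _ := mul_le_mul h1 h2 (by norm_num) measureReal_nonneg
  refine h3.trans (h.trans (measureReal_mono ?_))
  rintro ω ⟨h1, h2⟩
  exact ⟨h1.imp_right fun h => h.mono (cluster_mono Set.subset_union_left le_rfl),
    h2.imp_right fun h => h.mono (cluster_mono Set.subset_union_right le_rfl)⟩

/-- Three independent requirements, one per field: the field-0 cluster meets both sides (1/8), the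
link set is open, and at most two field-2 edges, chosen as functions of the cluster, are open (s²).
-/
theorem success_prob [G.LocallyFinite] (hG : G.Connected) (hΛ : Λ.Finite)
    (hE : Explored G S Λ U K Q) (hxy : G.Adj x y) (hxS : x ∉ S) (hyS : y ∉ S) (hxΛ : x ∈ Λ)
    (hη : FewOutBound G p s R r η) (hr : 0 < r) (h4 : η ≤ 1 / 4)
    (hx : x ∈ nearSide G S Λ U K ∨ x ∈ U ∧ 1 / 4 ≤ (fieldMeasure G p s).real
      {ω | HitsNear G S Λ U K (cluster U (localSet G U R x) ω)})
    (hy : y ∈ otherSide G S Λ U K ∨ y ∈ U ∧ (fieldMeasure G p s).real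
      {ω | HitsNear G S Λ U K (cluster U (localSet G U R y) ω)} < 1 / 4) :
    (s : ℝ) ^ (linkSet G S Λ U R x (seed G U R x y)).ncard * ((s : ℝ) ^ 2 / 8) ≤
      (fieldMeasure G p s).real {ω | (∀ i ∈ linkSet G S Λ U R x (seed G U R x y), ω i = true) ∧
        Joined G S U (cluster U (seed G U R x y) ω) (nextGraph S Λ U R x y K ω) ∧
        Linked G S Λ U K (nextGraph S Λ U R x y K ω)} := by
  classical
  have hU : U.Finite := hΛ.subset hE.subset
  have h8 := hits_both_prob hG hU hη hr h4 hx hy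
  -- The chosen edges F depend on C only, so conditionally on the cluster they are fresh.
  have pick1 : ∀ C : Set V, (x ∈ nearSide G S Λ U K ∨ HitsNear G S Λ U K C) →
      ∃ F : Finset (Coord G), F.card ≤ 1 ∧ (∀ i ∈ F, i.2 = 2) ∧ ∀ ω : Coord G → Bool,
        (∀ i ∈ F, ω i = true) → (x ∈ nearSide G S Λ U K ∨ (∃ v ∈ C, AdjTo G S v) ∨
          ∃ v ∈ C, ∃ z ∈ nearSide G S Λ U K, ∃ h : G.Adj v z, ω (coord h 2) = true) := by
    rintro C (h | ⟨v, hv, h | ⟨z, hz, h⟩⟩)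
    · exact ⟨∅, by simp, by simp, fun _ _ => Or.inl h⟩
    · exact ⟨∅, by simp, by simp, fun _ _ => Or.inr (Or.inl ⟨v, hv, h⟩)⟩
    · exact ⟨{coord h 2}, by simp, by simp, fun ω hω => Or.inr (Or.inr ⟨v, hv, z, hz, h,
        hω _ (Finset.mem_singleton_self _)⟩)⟩
  have pick2 : ∀ C : Set V, (y ∈ otherSide G S Λ U K ∨ HitsOther G S Λ U K C) →
      ∃ F : Finset (Coord G), F.card ≤ 1 ∧ (∀ i ∈ F, i.2 = 2) ∧ ∀ ω : Coord G → Bool,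
        (∀ i ∈ F, ω i = true) → (y ∈ otherSide G S Λ U K ∨
          ∃ v ∈ C, ∃ z ∈ otherSide G S Λ U K, ∃ h : G.Adj v z, ω (coord h 2) = true) := by
    rintro C (h | ⟨v, hv, z, hz, h⟩)
    · exact ⟨∅, by simp, by simp, fun _ _ => Or.inl h⟩
    · exact ⟨{coord h 2}, by simp, by simp, fun ω hω => Or.inr ⟨v, hv, z, hz, h,
        hω _ (Finset.mem_singleton_self _)⟩⟩
  choose! F1 hF1 hF1' hF1'' using pick1
  choose! F2 hF2 hF2' hF2'' using pick2
  set L := linkSet G S Λ U R x (seed G U R x y) with hL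
  have hLfin : L.Finite := finite_linkSet hΛ _
  have h1 := le_cluster_event (G := G) (p := p) (s := s) (b := seed G U R x y) hU
    (fun C => (x ∈ nearSide G S Λ U K ∨ HitsNear G S Λ U K C) ∧
      (y ∈ otherSide G S Λ U K ∨ HitsOther G S Λ U K C))
    (fun C => {ω | ∀ i ∈ L ∪ ↑(F1 C ∪ F2 C), ω i = true})
    (fun C => L ∪ ↑(F1 C ∪ F2 C)) (fun C _ => determined_link _) ?_ ?_
    (c := (s : ℝ) ^ L.ncard * (s : ℝ) ^ 2) ?_
  · calc (s : ℝ) ^ L.ncard * ((s : ℝ) ^ 2 / 8)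
        = (s : ℝ) ^ L.ncard * (s : ℝ) ^ 2 * (1 / 8) := by ring
      _ ≤ _ := mul_le_mul_of_nonneg_left h8
          (mul_nonneg (pow_nonneg s.2.1 _) (pow_nonneg s.2.1 _))
      _ ≤ _ := h1
      _ ≤ _ := measureReal_mono ?_
    rintro ω ⟨hP, hω⟩
    have hW : ∀ i ∈ L, ω i = true := fun i hi => hω i (Or.inl hi)
    refine ⟨hW, joined_and_linked hG hE hxy hxS hyS hxΛ hW ?_ ?_⟩
    · exact hF1'' _ hP.1 ω fun i hi => hω i (Or.inr (by simp [hi]))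
    · exact hF2'' _ hP.2 ω fun i hi => hω i (Or.inr (by simp [hi]))
  · rintro C ⟨hC1, hC2⟩
    refine Set.disjoint_left.2 fun i hi hi' => ?_
    rcases hi' with hi' | hi'
    · exact absurd (hi.1.symm.trans hi'.1) (by decide)
    · rcases Finset.mem_union.1 (Finset.mem_coe.1 hi') with h | h
      · exact absurd (hi.1.symm.trans (hF1' C hC1 i h)) (by decide)
      · exact absurd (hi.1.symm.trans (hF2' C hC2 i h)) (by decide)
  · exact fun C _ => hLfin.union (Finset.finite_toSet _)
  · rintro C ⟨hC1, hC2⟩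
    rw [bernProd_forall_true _ (hLfin.union (Finset.finite_toSet _)) s, ← pow_add]
    · refine pow_le_pow_of_le_one s.2.1 s.2.2 ((Set.ncard_union_le _ _).trans ?_)
      rw [Set.ncard_coe_finset]
      have := Finset.card_union_le (F1 C) (F2 C)
      have := hF1 C hC1
      have := hF2 C hC2
      omega
    · rintro i (hi | hi)
      · simp [fieldParam, hi.1]
      · rcases Finset.mem_union.1 (Finset.mem_coe.1 hi) with h | h
        · simp [fieldParam, hF1' C hC1 i h]
        · simp [fieldParam, hF2' C hC2 i h]

/-- An isolated cluster either has fewer than r exits, or has at least r exits whose field-2 copies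
are all closed. Both events are independent of the link set, whence the common factor. -/
theorem creation_prob [G.LocallyFinite] (hG : G.Connected) (hΛ : Λ.Finite)
    (hE : Explored G S Λ U K Q) (hxy : G.Adj x y) (hxS : x ∉ S) (hyS : y ∉ S) (hxΛ : x ∈ Λ)
    (hη : FewOutBound G p s R r η) (hη0 : 0 ≤ η) :
    (fieldMeasure G p s).real {ω | (∀ i ∈ linkSet G S Λ U R x (seed G U R x y), ω i = true) ∧
        ¬ Joined G S U (cluster U (seed G U R x y) ω) (nextGraph S Λ U R x y K ω)} ≤
      (s : ℝ) ^ (linkSet G S Λ U R x (seed G U R x y)).ncard * (η + (1 - (s : ℝ)) ^ r) := by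
  have hU : U.Finite := hΛ.subset hE.subset
  have hbU : seed G U R x y ⊆ U := seed_subset
  set L := linkSet G S Λ U R x (seed G U R x y) with hL
  have hLfin : L.Finite := finite_linkSet hΛ _
  have hs0 : 0 ≤ (s : ℝ) ^ L.ncard := pow_nonneg s.2.1 _
  have hs1 : 0 ≤ (1 - (s : ℝ)) ^ r := pow_nonneg (sub_nonneg.2 s.2.2) _
  by_cases hx : x ∈ U ∧ ∀ v, G.dist x v ≤ R → v ∈ localSet G U R x
  · set E1 := {ω : Coord G → Bool | ∀ i ∈ L, ω i = true} ∩
      {ω | (outEdges G U (cluster U (seed G U R x y) ω)).ncard < r}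
    set E2 := {ω : Coord G → Bool | r ≤ (outEdges G U (cluster U (seed G U R x y) ω)).ncard ∧
      ω ∈ {ω : Coord G → Bool | ∀ i ∈ L, ω i = true} ∩
        {ω | ∀ i ∈ inField 2 (outEdges G U (cluster U (seed G U R x y) ω)), ω i = false}}
    have h1 : (fieldMeasure G p s).real E1 ≤ (s : ℝ) ^ L.ncard * η := by
      rw [indep_of_determined_finite (fieldParam G p s) (determined_link L)
        (determined_cluster_event (G := G) (U := U) (fun C => (outEdges G U C).ncard < r) _)
        (Set.disjoint_left.2 fun i hi hi' => absurd (hi.1.symm.trans hi'.1) (by decide)) hLfin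
        (finite_inner hU), linkSet_prob hΛ]
      exact mul_le_mul_of_nonneg_left
        (hη U _ x hU hbU fun v hv => Or.inl (hx.2 v hv)) hs0
    have hdisj : ∀ C : Set V, Disjoint L (inField 2 (outEdges G U C)) := by
      intro C
      refine Set.disjoint_left.2 ?_
      rintro i hi ⟨e, _, rfl⟩
      exact absurd hi.1 (by decide : ¬ ((2 : Fin 3) = 1))
    have h2 : (fieldMeasure G p s).real E2 ≤ (s : ℝ) ^ L.ncard * (1 - (s : ℝ)) ^ r := by
      have h2 := cluster_event_le (G := G) (p := p) (s := s) (b := seed G U R x y) hU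
        (fun C => C ⊆ U ∧ r ≤ (outEdges G U C).ncard)
        (fun C => {ω | ∀ i ∈ L, ω i = true} ∩
          {ω | ∀ i ∈ inField 2 (outEdges G U C), ω i = false})
        (fun C => L ∪ inField 2 (outEdges G U C))
        (fun C _ => ((determined_link L).mono Set.subset_union_left).inter
          ((determined_closed _).mono Set.subset_union_right)) ?_ ?_ (mul_nonneg hs0 hs1) ?_
      · refine le_trans (measureReal_mono ?_) h2
        rintro ω ⟨h, h'⟩
        exact ⟨⟨cluster_subset hbU, h⟩, h'⟩
      · rintro C -
        refine Set.disjoint_left.2 ?_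
        rintro i hi (hi' | ⟨e, _, rfl⟩)
        · exact absurd (hi.1.symm.trans hi'.1) (by decide)
        · exact absurd hi.1 (by decide : ¬ ((2 : Fin 3) = 0))
      · rintro C ⟨hC, -⟩
        exact hLfin.union (finite_inField (hU.subset hC) 2)
      · rintro C ⟨hC, hr⟩
        rw [indep_of_determined_finite (fieldParam G p s) (determined_link L)
          (determined_closed _) (hdisj C) hLfin (finite_inField (hU.subset hC) 2),
          linkSet_prob hΛ, bernProd_forall_false _ (finite_inField (hU.subset hC) 2) s,
          ncard_inField]
        · exact mul_le_mul_of_nonneg_left (pow_le_pow_of_le_one (sub_nonneg.2 s.2.2)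
            (sub_le_self _ s.2.1) hr) hs0
        · rintro _ ⟨e, _, rfl⟩
          simp [fieldParam]
    rw [mul_add]
    refine le_trans (le_trans (measureReal_mono ?_) (measureReal_union_le E1 E2)) (add_le_add h1 h2)
    rintro ω ⟨hW, hJ⟩
    have hout := (of_not_joined hG hE hxy hxS hyS hxΛ hW hJ).2
    rcases Nat.lt_or_ge (outEdges G U (cluster U (seed G U R x y) ω)).ncard r with h | h
    · exact Or.inl ⟨hW, h⟩
    · refine Or.inr ⟨h, hW, ?_⟩
      rintro _ ⟨⟨e, heG⟩, ⟨⟨v, hve, hv⟩, z, hze, hz⟩, rfl⟩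
      have hvz : v ≠ z := fun hvz => hz (hvz ▸ cluster_subset hbU hv)
      obtain rfl : e = s(v, z) := ((Sym2.mem_and_mem_iff hvz).1 ⟨hve, hze⟩)
      exact (hout v hv z hz heG).2
  · have h0 : {ω : Coord G → Bool | (∀ i ∈ L, ω i = true) ∧
        ¬ Joined G S U (cluster U (seed G U R x y) ω) (nextGraph S Λ U R x y K ω)} = ∅ := by
      refine Set.eq_empty_of_forall_notMem fun ω hω => hx ?_
      exact (of_not_joined hG hE hxy hxS hyS hxΛ hω.1 hω.2).1
    rw [h0]
    simpa using mul_nonneg hs0 (add_nonneg hη0 hs1)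

end SuccessProbability

/-! ### Existence of a trial edge, and induction on the number of trials -/

section Induction

variable {V : Type*} {G : SimpleGraph V} {p s : unitInterval} {S Λ U : Set V} {R r : ℕ}
  {K : SimpleGraph V} {Q : Finset V} {Y : Finset V} {η : ℝ}

theorem finite_touchedEdges [G.LocallyFinite] (hS : S.Finite) (K : SimpleGraph V) :
    (touchedEdges G S Λ K).Finite :=
  (edgeBoundary_finite G hS).subset fun _ h => h.1

/-- The edges with an endpoint at distance at most `m` from `c`. -/
def edgesNear (G : SimpleGraph V) (m : ℕ) (c : V) : Set (Sym2 V) :=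
  {e | e ∈ G.edgeSet ∧ ∃ v ∈ e, G.dist c v ≤ m}

/-- The set Z contains S and is finite, so it has at least Φ(S) boundary edges. Fewer than t of
these are touched and at most N|Y| lie near earlier centres; any remaining edge serves. -/
theorem exists_trial_edge [G.LocallyFinite] (hΛ : Λ.Finite) (hS : S.Finite) (hSΛ : S ⊆ Λ)
    (hE : Explored G S Λ U K Q) {t N : ℕ} (ht : (touchedEdges G S Λ K).ncard < t)
    (hN : ∀ c, (edgesNear G (2 * R + 2) c).Finite ∧ (edgesNear G (2 * R + 2) c).ncard ≤ N)
    (hΦ : t + N * Y.card ≤ isoperimetric G S) :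
    ∃ x y, G.Adj x y ∧ x ∉ S ∧ y ∉ S ∧ x ∈ Λ ∧ (∀ c ∈ Y, 2 * R + 2 < G.dist c x) ∧
      (x ∈ nearSide G S Λ U K ∨ x ∈ U ∧ 1 / 4 ≤ (fieldMeasure G p s).real
        {ω | HitsNear G S Λ U K (cluster U (localSet G U R x) ω)}) ∧
      (y ∈ otherSide G S Λ U K ∨ y ∈ U ∧ (fieldMeasure G p s).real
        {ω | HitsNear G S Λ U K (cluster U (localSet G U R y) ω)} < 1 / 4) := by
  set Z : Set V := {v | v ∈ S ∨ v ∈ nearSide G S Λ U K ∨ v ∈ U ∧ 1 / 4 ≤ (fieldMeasure G p s).real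
        {ω | HitsNear G S Λ U K (cluster U (localSet G U R v) ω)}} with hZ
  have hnear : ∀ v ∈ nearSide G S Λ U K, v ∈ Λ := by
    intro v hv
    by_contra h
    exact hv.2.2.1 ⟨v, h, SimpleGraph.Reachable.refl _⟩
  have hZΛ : Z ⊆ Λ := by
    rintro v (h | h | h)
    exacts [hSΛ h, hnear v h, hE.subset h.1]
  have hZfin : Z.Finite := hΛ.subset hZΛ
  have h1 : isoperimetric G S ≤ (edgeBoundary G Z).ncard :=
    Nat.sInf_le ⟨Z, fun v hv => Or.inl hv, hZfin, rfl⟩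
  set F : Set (Sym2 V) := touchedEdges G S Λ K ∪ ⋃ c ∈ Y, edgesNear G (2 * R + 2) c with hF
  have hUfin : (⋃ c ∈ Y, edgesNear G (2 * R + 2) c).Finite :=
    Y.finite_toSet.biUnion fun c _ => (hN c).1
  have hFfin : F.Finite := (finite_touchedEdges hS K).union hUfin
  have hUcard : (⋃ c ∈ Y, edgesNear G (2 * R + 2) c).ncard ≤ N * Y.card := by
    refine (Finset.set_ncard_biUnion_le Y _).trans ?_
    refine (Finset.sum_le_card_nsmul Y _ N fun c _ => (hN c).2).trans ?_
    rw [smul_eq_mul, mul_comm]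
  have hFcard : F.ncard < (edgeBoundary G Z).ncard := by
    have := Set.ncard_union_le (touchedEdges G S Λ K) (⋃ c ∈ Y, edgesNear G (2 * R + 2) c)
    rw [← hF] at this
    omega
  obtain ⟨e, he, heF⟩ := Set.exists_mem_notMem_of_ncard_lt_ncard hFcard hFfin
  obtain ⟨heG, x, hx, y, hy, rfl⟩ := he
  have hxy : G.Adj x y := heG
  have hyS : y ∉ S := fun h => hy (Or.inl h)
  have hyc : y ∈ otherSide G S Λ U K ∨ y ∈ U ∧ (fieldMeasure G p s).real
        {ω | HitsNear G S Λ U K (cluster U (localSet G U R y) ω)} < 1 / 4 := by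
    by_cases hyU : y ∈ U
    · exact Or.inr ⟨hyU, lt_of_not_ge fun h => hy (Or.inr (Or.inr ⟨hyU, h⟩))⟩
    · exact Or.inl ⟨hyS, hyU, fun h => hy (Or.inr (Or.inl h))⟩
  -- If x were in S, then y would be adjacent to S: explored and not near, y would be connected to
  -- Λᶜ and the edge already touched; unexplored, y would reach the near side with probability 1.
  have hxS : x ∉ S := by
    intro hxS
    have hadj : AdjTo G S y := ⟨x, hxS, hxy⟩
    rcases hyc with hyo | ⟨hyU, hlt⟩
    · have hfar : Far Λ K y := by
        by_contra hf
        exact hyo.2.2 ⟨hyS, hyo.2.1, hf, y, hadj, SimpleGraph.Reachable.refl _⟩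
      exact heF (Or.inl ⟨⟨heG, x, hxS, y, hyS, rfl⟩, y, Sym2.mem_mk_right _ _, hyS, hfar⟩)
    · have : {ω : Coord G → Bool | HitsNear G S Λ U K (cluster U (localSet G U R y) ω)} =
          Set.univ := Set.eq_univ_of_forall fun ω =>
        ⟨y, subset_cluster (mem_localSet_self hyU), Or.inl hadj⟩
      rw [this, probReal_univ] at hlt
      norm_num at hlt
  refine ⟨x, y, hxy, hxS, hyS, hZΛ hx, fun c hc => ?_, hx.resolve_left hxS, hyc⟩
  by_contra hd
  refine heF (Or.inr (Set.mem_biUnion (x := c) hc ⟨heG, x, Sym2.mem_mk_left _ _, not_lt.1 hd⟩))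

theorem determined_finalGraph (K : SimpleGraph V) (A : Set (Coord G)) (P : SimpleGraph V → Prop) :
    Determined {ω | P (finalGraph K A ω)} A := by
  intro ω ω' h hω
  change P _
  have : finalGraph K A ω' = finalGraph K A ω := by
    unfold finalGraph; rw [openSet_congr h]
  rw [this]
  exact hω

theorem weight_le {q q' j j' t : ℕ} {ρ c : ℝ} {n : ℕ} (hρ : 0 ≤ ρ)
    (h : (2 : ℝ) ^ q' * 2 ^ j ≤ c * (2 ^ q * 2 ^ j')) :
    (2 : ℝ) ^ q' * 2 ^ t / 2 ^ j' * ρ ^ n ≤ 2 ^ q * 2 ^ t / 2 ^ j * ρ ^ n * c := by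
  have h2 : (2 : ℝ) ^ q' / 2 ^ j' ≤ c * (2 ^ q / 2 ^ j) := by
    rw [div_le_iff₀ (by positivity)]
    calc (2 : ℝ) ^ q' = 2 ^ q' * 2 ^ j / 2 ^ j := by field_simp
      _ ≤ c * (2 ^ q * 2 ^ j') / 2 ^ j := by gcongr
      _ = c * (2 ^ q / 2 ^ j) * 2 ^ j' := by ring
  calc (2 : ℝ) ^ q' * 2 ^ t / 2 ^ j' * ρ ^ n = 2 ^ q' / 2 ^ j' * (2 ^ t * ρ ^ n) := by ring
    _ ≤ c * (2 ^ q / 2 ^ j) * (2 ^ t * ρ ^ n) :=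
        mul_le_mul_of_nonneg_right h2 (by positivity)
    _ = _ := by ring

open Classical in
/-- The bound for the probability of touching fewer than `t` edges, by induction on the number of
trials. -/
theorem touched_lt_prob_le [G.LocallyFinite] (hG : G.Connected) (hΛ : Λ.Finite) (hS : S.Finite)
    (hSΛ : S ⊆ Λ) (hη : FewOutBound G p s R r η) (hη0 : 0 ≤ η) (hr : 0 < r) (h4 : η ≤ 1 / 4)
    (hsmall : η + (1 - (s : ℝ)) ^ r ≤ (s : ℝ) ^ 2 / 32) {t N m : ℕ}
    (hN : ∀ c, (edgesNear G (2 * R + 2) c).Finite ∧ (edgesNear G (2 * R + 2) c).ncard ≤ N)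
    (hm : ∀ (U : Set V) (x : V) (b : Set V), (linkSet G S Λ U R x b).ncard ≤ m) :
    ∀ (n : ℕ) (U : Set V) (K : SimpleGraph V) (Q Y : Finset V), Explored G S Λ U K Q →
      t + N * (Y.card + n) ≤ isoperimetric G S →
      (fieldMeasure G p s).real
        {ω | (touchedEdges G S Λ (finalGraph K (aliveSet G S Λ U R Y) ω)).ncard < t} ≤
      2 ^ Q.card * 2 ^ t / 2 ^ (touchedEdges G S Λ K).ncard *
        (1 - (s : ℝ) ^ m * ((s : ℝ) ^ 2 / 32)) ^ n := by
  set ρ : ℝ := 1 - (s : ℝ) ^ m * ((s : ℝ) ^ 2 / 32) with hρdef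
  have hs0 : (0 : ℝ) ≤ s := s.2.1
  have hs1 : (s : ℝ) ≤ 1 := s.2.2
  have hρ : 0 ≤ ρ := by
    have h1 : (s : ℝ) ^ m ≤ 1 := pow_le_one₀ hs0 hs1
    have h2 : (s : ℝ) ^ 2 ≤ 1 := pow_le_one₀ hs0 hs1
    have h3 : (s : ℝ) ^ m * ((s : ℝ) ^ 2 / 32) ≤ 1 * 1 :=
      mul_le_mul h1 (by linarith) (by positivity) zero_le_one
    linarith
  have hempty : ∀ (U : Set V) (K : SimpleGraph V) (Y : Finset V),
      t ≤ (touchedEdges G S Λ K).ncard → (fieldMeasure G p s).real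
        {ω | (touchedEdges G S Λ (finalGraph K (aliveSet G S Λ U R Y) ω)).ncard < t} = 0 := by
    intro U K Y h
    have : {ω | (touchedEdges G S Λ (finalGraph K (aliveSet G S Λ U R Y) ω)).ncard < t} = ∅ := by
      refine Set.eq_empty_of_forall_notMem fun ω hω => ?_
      have h2 := Set.ncard_le_ncard (touchedEdges_mono (G := G) (S := S) (Λ := Λ)
        (le_sup_left : K ≤ finalGraph K (aliveSet G S Λ U R Y) ω)) (finite_touchedEdges hS _)
      exact absurd (lt_of_le_of_lt (h.trans h2) hω) (lt_irrefl _)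
    rw [this]; simp
  intro n
  induction n with
  | zero =>
    intro U K Q Y hE hΦ
    rcases Nat.lt_or_ge (touchedEdges G S Λ K).ncard t with h | h
    -- With fewer than t touched edges the weight 2^|Q| 2^t / 2^j is at least 1, so the trivial
    -- bound suffices.
    · refine measureReal_le_one.trans ?_
      have h1 : (1 : ℝ) ≤ 2 ^ Q.card := one_le_pow₀ one_le_two
      have h2 : (2 : ℝ) ^ (touchedEdges G S Λ K).ncard ≤ 2 ^ t :=
        pow_le_pow_right₀ one_le_two h.le
      rw [pow_zero, mul_one, le_div_iff₀ (by positivity), one_mul]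
      nlinarith [pow_pos (two_pos (α := ℝ)) t]
    · rw [hempty U K Y h]; positivity
  | succ n ih =>
    intro U K Q Y hE hΦ
    rcases Nat.lt_or_ge (touchedEdges G S Λ K).ncard t with ht | ht
    swap
    · rw [hempty U K Y ht]
      exact mul_nonneg (by positivity) (pow_nonneg hρ _)
    obtain ⟨x, y, hxy, hxS, hyS, hxΛ, hxY, hx, hy⟩ := exists_trial_edge (p := p) (s := s) (Y := Y)
      hΛ hS hSΛ hE ht hN (le_trans (Nat.add_le_add_left (Nat.mul_le_mul_left N (by omega)) t) hΦ)
    have hcardY : (insert x Y).card ≤ Y.card + 1 := Finset.card_insert_le _ _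
    have hΦ' : t + N * ((insert x Y).card + n) ≤ isoperimetric G S :=
      le_trans (Nat.add_le_add_left (Nat.mul_le_mul_left N (by omega)) t) hΦ
    have hU : U.Finite := hΛ.subset hE.subset
    set b := seed G U R x y with hb
    set μ := fieldMeasure G p s with hμ
    set τ := trial (G := G) S Λ U R x b with hτ
    set M : ℝ := 2 ^ Q.card * 2 ^ t / 2 ^ (touchedEdges G S Λ K).ncard * ρ ^ n with hM
    have hM0 : 0 ≤ M := mul_nonneg (by positivity) (pow_nonneg hρ _)
    let D : Option (Set V × Set (Coord G)) → Set (Coord G → Bool) := fun o => o.elim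
      {ω | (touchedEdges G S Λ (finalGraph K (aliveSet G S Λ U R (insert x Y)) ω)).ncard < t}
      fun c => {ω | (touchedEdges G S Λ (finalGraph (K ⊔ edgeGraph c.2)
        (aliveSet G S Λ (U \ c.1) R (insert x Y)) ω)).ncard < t}
    let J : Option (Set V × Set (Coord G)) → Set (Coord G) := fun o => o.elim
      (aliveSet G S Λ U R (insert x Y)) fun c => aliveSet G S Λ (U \ c.1) R (insert x Y)
    let suc : Option (Set V × Set (Coord G)) → Prop := fun o => o.elim False fun c =>
      Joined G S U c.1 (K ⊔ edgeGraph c.2) ∧ Linked G S Λ U K (K ⊔ edgeGraph c.2)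
    let cre : Option (Set V × Set (Coord G)) → Prop := fun o => o.elim False fun c =>
      ¬ Joined G S U c.1 (K ⊔ edgeGraph c.2)
    have halive : (aliveSet G S Λ U R Y).Finite := finite_aliveSet hΛ hE.subset
    have hclus : ∀ ω : Coord G → Bool, cluster U b ω ⊆ U := fun ω => cluster_subset seed_subset
    have hsome : ∀ ω, (∀ i ∈ linkSet G S Λ U R x b, ω i = true) → τ ω =
        some (cluster U b ω, openSet (revealSet G S Λ U R x b (cluster U b ω)) ω) :=
      fun ω h => trial_eq_some.2 ⟨h, rfl, rfl⟩
    have hcases : ∀ ω, τ ω = none ∨ ((∀ i ∈ linkSet G S Λ U R x b, ω i = true) ∧ τ ω =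
        some (cluster U b ω, openSet (revealSet G S Λ U R x b (cluster U b ω)) ω)) := by
      intro ω
      by_cases h : ∀ i ∈ linkSet G S Λ U R x b, ω i = true
      · exact Or.inr ⟨h, hsome ω h⟩
      · exact Or.inl (trial_eq_none.2 h)
    have hrange : (Set.range τ).Finite := by
      refine finite_range_of_determined halive fun ω ω' h => ?_
      have hd := determined_trial (G := G) (S := S) (Λ := Λ) (U := U) (R := R) (x := x) (b := b)
        (τ ω) ω ω' ?_ rfl
      · exact hd.symm
      · intro i hi
        refine h i ?_
        rcases hcases ω with h0 | ⟨-, h0⟩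
        · rw [h0] at hi
          exact link_subset_alive hG hxY hi
        · rw [h0] at hi
          exact reveal_subset_alive hG hxY (hclus ω) hi
    set T := hrange.toFinset with hT
    have hTmem : ∀ ω, τ ω ∈ T := fun ω => by simp [hT]
    have hT' : ∀ o ∈ T, ∃ ω, τ ω = o := fun o ho => by simpa [hT] using ho
    have hTcases : ∀ o ∈ T, o = none ∨ ∃ ω, (∀ i ∈ linkSet G S Λ U R x b, ω i = true) ∧ o =
        some (cluster U b ω, openSet (revealSet G S Λ U R x b (cluster U b ω)) ω) := by
      intro o ho
      obtain ⟨ω, rfl⟩ := hT' o ho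
      rcases hcases ω with h | ⟨h, h'⟩
      exacts [Or.inl h, Or.inr ⟨ω, h, h'⟩]
    have hfib : ∀ o ∈ T, Determined (τ ⁻¹' {o}) (trialSet G S Λ U R x b o) :=
      fun o _ => determined_trial o
    have hfibfin : ∀ o ∈ T, (trialSet G S Λ U R x b o).Finite := by
      intro o ho
      rcases hTcases o ho with rfl | ⟨ω, -, rfl⟩
      · exact finite_linkSet hΛ b
      · exact halive.subset (reveal_subset_alive hG hxY (hclus ω))
    -- the bad event is contained in the bad event after the trial
    have hstep : μ.real {ω | (touchedEdges G S Λ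
        (finalGraph K (aliveSet G S Λ U R Y) ω)).ncard < t} ≤ μ.real {ω | ω ∈ D (τ ω)} := by
      refine measureReal_mono fun ω hω => ?_
      have hlt : ∀ H : SimpleGraph V, H ≤ finalGraph K (aliveSet G S Λ U R Y) ω →
          (touchedEdges G S Λ H).ncard < t := fun H hH =>
        lt_of_le_of_lt (Set.ncard_le_ncard (touchedEdges_mono hH) (finite_touchedEdges hS _)) hω
      rcases hcases ω with h | ⟨-, h⟩
      · change ω ∈ D (τ ω)
        rw [h]
        refine hlt _ (finalGraph_mono le_sup_left ?_)
        have := alive_subset (G := G) (S := S) (Λ := Λ) (U := U) (R := R) (x := x) (Y := Y) ∅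
        rwa [Set.sdiff_empty] at this
      · change ω ∈ D (τ ω)
        rw [h]
        refine hlt _ (finalGraph_mono (sup_le le_sup_left ?_) (alive_subset _))
        exact (edgeGraph_mono (openSet_mono (reveal_subset_alive hG hxY (hclus ω)) ω)).trans
          le_sup_right
    have hsum := measureReal_eq_sum_fibers (fieldParam G p s) τ D (trialSet G S Λ U R x b) J T
      hTmem hfib ?_ ?_ hfibfin ?_
    rotate_left
    · intro o _
      cases o with
      | none => exact determined_finalGraph K _ fun H => (touchedEdges G S Λ H).ncard < t
      | some c =>
        exact determined_finalGraph (K ⊔ edgeGraph c.2) _ fun H => (touchedEdges G S Λ H).ncard < t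
    · intro o _
      cases o with
      | none => exact disjoint_link_alive
      | some c => exact disjoint_reveal_alive c.1
    · intro o _
      cases o with
      | none => exact finite_aliveSet hΛ hE.subset
      | some c => exact finite_aliveSet hΛ (Set.sdiff_subset.trans hE.subset)
    -- bounds for the individual outcomes
    have hbound : ∀ o ∈ T, μ.real (D o) ≤
        M * (1 - (if suc o then 1 / 2 else 0) + (if cre o then 1 else 0)) := by
      intro o ho
      rcases hTcases o ho with rfl | ⟨ω, hW, rfl⟩
      · have h := ih U K Q (insert x Y) hE hΦ'
        simpa [D, suc, cre] using h
      · set C := cluster U b ω with hC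
        set O := openSet (revealSet G S Λ U R x b C) ω with hO
        set K' := K ⊔ edgeGraph O with hK'
        have hK'' : nextGraph S Λ U R x y K ω = K' := rfl
        have hKK' : K ≤ K' := le_sup_left
        have hadj : ∀ u v, K'.Adj u v → u ∉ S ∧ (u ∉ U ∨ u ∈ C) :=
          hE.adj_next (x := x) (y := y) (R := R) (hclus ω) (fun i hi => hi.1) subset_cluster
            fun i hi h0 => openSet_reveal_mem_cluster hi h0
        have hj : (touchedEdges G S Λ K).ncard ≤ (touchedEdges G S Λ K').ncard :=
          Set.ncard_le_ncard (touchedEdges_mono hKK') (finite_touchedEdges hS _)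
        have hpj : (2 : ℝ) ^ (touchedEdges G S Λ K).ncard ≤
            2 ^ (touchedEdges G S Λ K').ncard := pow_le_pow_right₀ one_le_two hj
        have hDeq : D (some (C, O)) = {ω | (touchedEdges G S Λ (finalGraph K'
          (aliveSet G S Λ (U \ C) R (insert x Y)) ω)).ncard < t} := rfl
        by_cases hJ : Joined G S U C K'
        · have hcre : ¬ cre (some (C, O)) := fun h => h hJ
          by_cases hL : Linked G S Λ U K K'
          · have hsuc : suc (some (C, O)) := ⟨hJ, hL⟩
            rw [if_pos hsuc, if_neg hcre, hDeq]
            -- Both alternatives halve the weight: j grows by at least one, or |Q| drops by one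
            -- while j does not decrease.
            rcases hE.next_success hKK' hadj hJ hL with ⟨hE', e, he, he'⟩ | ⟨q, hq, hE'⟩
            · refine (ih _ _ _ _ hE' hΦ').trans ((weight_le (q := Q.card) (j := (touchedEdges G S Λ K).ncard) hρ (c := 1 / 2) ?_).trans
                (le_of_eq (by rw [hM]; ring)))
              have h1 : (touchedEdges G S Λ K).ncard < (touchedEdges G S Λ K').ncard :=
                Set.ncard_lt_ncard ((Set.ssubset_iff_of_subset (touchedEdges_mono hKK')).2
                  ⟨e, he, he'⟩) (finite_touchedEdges hS _)
              have h2 : (2 : ℝ) ^ ((touchedEdges G S Λ K).ncard + 1) ≤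
                  2 ^ (touchedEdges G S Λ K').ncard := pow_le_pow_right₀ one_le_two h1
              rw [pow_succ] at h2
              nlinarith [pow_pos (two_pos (α := ℝ)) Q.card]
            · refine (ih _ _ _ _ hE' hΦ').trans ((weight_le (q := Q.card) (j := (touchedEdges G S Λ K).ncard) hρ (c := 1 / 2) ?_).trans
                (le_of_eq (by rw [hM]; ring)))
              have h1 : (2 : ℝ) ^ (Q.erase q).card * 2 = 2 ^ Q.card := by
                rw [← pow_succ, Finset.card_erase_add_one hq]
              have h3 : (2 : ℝ) ^ (Q.erase q).card = 1 / 2 * 2 ^ Q.card := by linarith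
              rw [h3, mul_assoc]
              gcongr
          · have hsuc : ¬ suc (some (C, O)) := fun h => hL h.2
            rw [if_neg hsuc, if_neg hcre, hDeq]
            refine (ih _ _ _ _ (hE.next_joined hKK' hadj hJ) hΦ').trans
              ((weight_le (q := Q.card) (j := (touchedEdges G S Λ K).ncard) hρ (c := 1) ?_).trans (le_of_eq (by rw [hM]; ring)))
            rw [one_mul]
            gcongr
        · have hcre : cre (some (C, O)) := hJ
          have hsuc : ¬ suc (some (C, O)) := fun h => hJ h.1
          rw [if_neg hsuc, if_pos hcre, hDeq]
          have hc : ∀ v ∈ C, K'.Reachable v x := fun v hv =>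
            nextGraph_reachable_of_mem_cluster hG hE hxy hxS hyS hxΛ hW hv
          refine (ih _ _ _ _ (hE.next_new hKK' hadj x hc) hΦ').trans
              ((weight_le (q := Q.card) (j := (touchedEdges G S Λ K).ncard) hρ (c := 2) ?_).trans (le_of_eq (by rw [hM]; ring)))
          have h1 : (2 : ℝ) ^ (insert x Q).card ≤ 2 ^ (Q.card + 1) :=
            pow_le_pow_right₀ one_le_two (Finset.card_insert_le _ _)
          rw [pow_succ] at h1
          calc (2 : ℝ) ^ (insert x Q).card * 2 ^ (touchedEdges G S Λ K).ncard
              ≤ 2 ^ Q.card * 2 * 2 ^ (touchedEdges G S Λ K').ncard := by gcongr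
            _ = _ := by ring
    -- the expectation of the weights
    have hsucP := measureReal_preimage_eq_sum (fieldParam G p s) τ (trialSet G S Λ U R x b) T
      hTmem hfib hfibfin suc
    have hcreP := measureReal_preimage_eq_sum (fieldParam G p s) τ (trialSet G S Λ U R x b) T
      hTmem hfib hfibfin cre
    have hallP := measureReal_preimage_eq_sum (fieldParam G p s) τ (trialSet G S Λ U R x b) T
      hTmem hfib hfibfin (fun _ => True)
    have hall : ∑ o ∈ T, μ.real (τ ⁻¹' {o}) = 1 := by
      have : {ω : Coord G → Bool | True} = Set.univ := rfl
      rw [this, probReal_univ] at hallP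
      simpa using hallP.symm
    have hexp : ∑ o ∈ T, μ.real (τ ⁻¹' {o}) * μ.real (D o) ≤
        M * (1 - μ.real {ω | suc (τ ω)} / 2 + μ.real {ω | cre (τ ω)}) := by
      calc ∑ o ∈ T, μ.real (τ ⁻¹' {o}) * μ.real (D o)
          ≤ ∑ o ∈ T, μ.real (τ ⁻¹' {o}) *
            (M * (1 - (if suc o then 1 / 2 else 0) + (if cre o then 1 else 0))) :=
            Finset.sum_le_sum fun o ho =>
              mul_le_mul_of_nonneg_left (hbound o ho) measureReal_nonneg
        _ = M * (∑ o ∈ T, μ.real (τ ⁻¹' {o}) -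
              (∑ o ∈ T, if suc o then μ.real (τ ⁻¹' {o}) else 0) / 2 +
              ∑ o ∈ T, if cre o then μ.real (τ ⁻¹' {o}) else 0) := by
            rw [Finset.sum_div, ← Finset.sum_sub_distrib, ← Finset.sum_add_distrib, Finset.mul_sum]
            refine Finset.sum_congr rfl fun o _ => ?_
            split_ifs <;> ring
        _ = _ := by rw [hall, hsucP, hcreP]
    have hsuc_ge : (s : ℝ) ^ (linkSet G S Λ U R x b).ncard * ((s : ℝ) ^ 2 / 8) ≤
        μ.real {ω | suc (τ ω)} := by
      refine (success_prob hG hΛ hE hxy hxS hyS hxΛ hη hr h4 hx hy).trans (measureReal_mono ?_)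
      rintro ω ⟨hW, hJL⟩
      change suc (τ ω)
      rw [hsome ω hW]
      exact hJL
    have hcre_le : μ.real {ω | cre (τ ω)} ≤
        (s : ℝ) ^ (linkSet G S Λ U R x b).ncard * (η + (1 - (s : ℝ)) ^ r) := by
      refine (measureReal_mono ?_).trans (creation_prob hG hΛ hE hxy hxS hyS hxΛ hη hη0)
      intro ω hω
      have hω : cre (τ ω) := hω
      rcases hcases ω with h | ⟨hW, h⟩
      · rw [h] at hω
        exact hω.elim
      · rw [h] at hω
        exact ⟨hW, hω⟩
    have hκ : (s : ℝ) ^ m ≤ (s : ℝ) ^ (linkSet G S Λ U R x b).ncard :=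
      pow_le_pow_of_le_one hs0 hs1 (hm U x b)
    -- A success saves half its probability, at least s^|L| s²/16; creation costs at most s^|L|
    -- s²/32. The net gain is at least s^m s²/32, as |L| ≤ m.
    have hfactor : 1 - μ.real {ω | suc (τ ω)} / 2 + μ.real {ω | cre (τ ω)} ≤ ρ := by
      have h1 : (s : ℝ) ^ (linkSet G S Λ U R x b).ncard * (η + (1 - (s : ℝ)) ^ r) ≤
          (s : ℝ) ^ (linkSet G S Λ U R x b).ncard * ((s : ℝ) ^ 2 / 32) :=
        mul_le_mul_of_nonneg_left hsmall (by positivity)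
      have h2 : (s : ℝ) ^ m * ((s : ℝ) ^ 2 / 32) ≤
          (s : ℝ) ^ (linkSet G S Λ U R x b).ncard * ((s : ℝ) ^ 2 / 32) :=
        mul_le_mul_of_nonneg_right hκ (by positivity)
      rw [hρdef]
      linarith
    calc μ.real {ω | (touchedEdges G S Λ (finalGraph K (aliveSet G S Λ U R Y) ω)).ncard < t}
        ≤ ∑ o ∈ T, μ.real (τ ⁻¹' {o}) * μ.real (D o) := hstep.trans hsum.le
      _ ≤ M * ρ := hexp.trans (mul_le_mul_of_nonneg_left hfactor hM0)
      _ = _ := by rw [hM, pow_succ]; ring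

end Induction

/-! ### Measurability, and almost sure existence of an infinite cluster -/

section ZeroOne

variable {V : Type*} {G : SimpleGraph V} {p : unitInterval} {o : V}

/-- The graph of the open edges that belong to `D`. -/
def openIn (D : Set (Sym2 V)) (ω : Config G) : SimpleGraph V :=
  SimpleGraph.fromEdgeSet (openEdges ω ∩ D)

theorem openIn_adj {D : Set (Sym2 V)} {ω : Config G} {u v : V} :
    (openIn D ω).Adj u v ↔ s(u, v) ∈ D ∧ ∃ h : s(u, v) ∈ G.edgeSet, ω ⟨s(u, v), h⟩ = true := by
  simp only [openIn, SimpleGraph.fromEdgeSet_adj, openEdges, Set.mem_inter_iff, Set.mem_ofPred_eq]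
  constructor
  · rintro ⟨⟨h, hD⟩, -⟩
    exact ⟨hD, h⟩
  · rintro ⟨hD, h⟩
    exact ⟨⟨h, hD⟩, G.ne_of_adj h.1⟩

/-- Follow the path only up to its first vertex outside Λ; every edge used until then starts in Λ.
-/
theorem Far.congr {Λ : Set V} {K K' : SimpleGraph V} {u : V} (h : Far Λ K u)
    (hK : ∀ u v, u ∈ Λ → K.Adj u v → K'.Adj u v) : Far Λ K' u := by
  obtain ⟨w, hw, hr⟩ := h
  rw [SimpleGraph.reachable_iff_reflTransGen] at hr
  induction hr using Relation.ReflTransGen.head_induction_on with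
  | refl => exact ⟨w, hw, SimpleGraph.Reachable.refl _⟩
  | @head a c hac _ ih =>
    by_cases ha : a ∈ Λ
    · obtain ⟨z, hz, hr⟩ := ih
      exact ⟨z, hz, (hK a c ha hac).reachable.trans hr⟩
    · exact ⟨a, ha, SimpleGraph.Reachable.refl _⟩

theorem determined_far (D : Set (Sym2 V)) (Λ : Set V) (P : (V → Prop) → Prop) :
    Determined {ω : Config G | P (Far Λ (openIn D ω))} {e | ∃ v ∈ (e : Sym2 V), v ∈ Λ} := by
  have key : ∀ ω ω' : Config G, (∀ e ∈ {e : G.edgeSet | ∃ v ∈ (e : Sym2 V), v ∈ Λ}, ω e = ω' e) →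
      ∀ v, Far Λ (openIn D ω) v → Far Λ (openIn D ω') v := by
    intro ω ω' h v hv
    refine hv.congr fun a c ha hac => ?_
    rw [openIn_adj] at hac ⊢
    obtain ⟨hD, hG, ho⟩ := hac
    refine ⟨hD, hG, ?_⟩
    rw [← h ⟨s(a, c), hG⟩ ⟨a, Sym2.mem_mk_left _ _, ha⟩]
    exact ho
  intro ω ω' h hω
  change P _
  have : Far Λ (openIn D ω') = Far Λ (openIn D ω) := by
    funext v
    exact propext ⟨key ω' ω (fun e he => (h e he).symm) v, key ω ω' h v⟩
  rw [this]
  exact hω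

theorem finite_edges_meeting [G.LocallyFinite] {Λ : Set V} (hΛ : Λ.Finite) :
    {e : G.edgeSet | ∃ v ∈ (e : Sym2 V), v ∈ Λ}.Finite :=
  ((finite_coords (G := G) hΛ).image Prod.fst).subset fun e he => ⟨(e, 0), he, rfl⟩

theorem measurableSet_far [G.LocallyFinite] (D : Set (Sym2 V)) {Λ : Set V} (hΛ : Λ.Finite)
    (P : (V → Prop) → Prop) : MeasurableSet {ω : Config G | P (Far Λ (openIn D ω))} :=
  (determined_far D Λ P).measurableSet (finite_edges_meeting hΛ)

/-- The ball of radius `n` around `o`. -/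
def ball (G : SimpleGraph V) (o : V) (n : ℕ) : Set V := {v | G.dist o v ≤ n}

theorem ball_mono {m n : ℕ} (h : m ≤ n) : ball G o m ⊆ ball G o n :=
  fun _ hv => le_trans hv h

theorem finite_ball [G.LocallyFinite] (hG : G.Connected) (o : V) (n : ℕ) : (ball G o n).Finite := by
  induction n with
  | zero =>
    refine (Set.finite_singleton o).subset fun v hv => ?_
    have : G.dist o v = 0 := Nat.le_zero.1 hv
    exact (hG.dist_eq_zero_iff.1 this).symm
  | succ n ih =>
    refine (ih.union (ih.biUnion fun u _ => Set.toFinite (G.neighborSet u))).subset fun v hv => ?_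
    rcases Nat.lt_or_ge n (G.dist o v) with h | h
    · obtain ⟨u, hu, hd⟩ := exists_adj_dist_le hG (le_antisymm hv h)
      exact Or.inr (Set.mem_biUnion (show u ∈ ball G o n from hd) hu)
    · exact Or.inl h

theorem exists_subset_ball {L : Set V} (hL : L.Finite) (o : V) : ∃ n, L ⊆ ball G o n := by
  obtain ⟨n, hn⟩ := (hL.image (G.dist o)).bddAbove
  exact ⟨n, fun v hv => hn (Set.mem_image_of_mem _ hv)⟩

theorem ConnectedToInfinity.exists_far {F : Set (Sym2 V)} {L Λ : Set V}
    (h : ConnectedToInfinity F L) (hΛ : Λ.Finite) :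
    ∃ u ∈ L, Far Λ (SimpleGraph.fromEdgeSet F) u := by
  obtain ⟨v, ⟨u, hu, hr⟩, hv⟩ := h.exists_notMem_finite hΛ
  exact ⟨u, hu, v, hv, hr⟩

theorem exists_ball_not_far {F : Set (Sym2 V)} {L : Set V} (h : ¬ ConnectedToInfinity F L) (o : V) :
    ∃ n, ∀ m, n ≤ m → ∀ u ∈ L, ¬ Far (ball G o m) (SimpleGraph.fromEdgeSet F) u := by
  obtain ⟨n, hn⟩ := exists_subset_ball (G := G) (Set.not_infinite.1 h) o
  refine ⟨n, fun m hm u hu hf => ?_⟩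
  obtain ⟨w, hw, hr⟩ := hf
  exact hw (ball_mono hm (hn ⟨u, hu, hr⟩))

theorem ConnectedToInfinity.mono {F : Set (Sym2 V)} {L L' : Set V} (h : ConnectedToInfinity F L)
    (hL : L ⊆ L') : ConnectedToInfinity F L' := by
  refine Set.Infinite.mono ?_ h
  rintro v ⟨u, hu, hr⟩
  exact ⟨u, hL hu, hr⟩

theorem ConnectedToInfinity.exists_singleton {F : Set (Sym2 V)} {L : Set V}
    (h : ConnectedToInfinity F L) (hL : L.Finite) : ∃ u ∈ L, ConnectedToInfinity F {u} := by
  by_contra! hc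
  have h' : (⋃ u ∈ L, {v | ∃ a ∈ ({u} : Set V), (SimpleGraph.fromEdgeSet F).Reachable a v}).Finite :=
    hL.biUnion fun u hu => Set.not_infinite.1 (hc u hu)
  refine h (h'.subset ?_)
  rintro v ⟨u, hu, hr⟩
  exact Set.mem_biUnion hu ⟨u, rfl, hr⟩

/-- An infinite set leaves every ball, and a finite one is contained in some ball. This exhibits the
event as a countable intersection of events of finitely many edges. -/
theorem connectedToInfinity_iff [G.LocallyFinite] (hG : G.Connected) (o : V) {ω : Config G}
    {L : Set V} : ConnectedToInfinity (openEdges ω) L ↔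
      ∀ n, ∃ u ∈ L, Far (ball G o n) (openIn Set.univ ω) u := by
  unfold openIn
  rw [Set.inter_univ]
  refine ⟨fun h n => h.exists_far (finite_ball hG o n), fun h => ?_⟩
  by_contra hc
  obtain ⟨n, hn⟩ := exists_ball_not_far (G := G) hc o
  obtain ⟨u, hu, hf⟩ := h n
  exact hn n le_rfl u hu hf

theorem measurableSet_connectedToInfinity [G.LocallyFinite] (hG : G.Connected) (L : Set V) :
    MeasurableSet {ω : Config G | ConnectedToInfinity (openEdges ω) L} := by
  have o : V := hG.nonempty.some
  simp_rw [connectedToInfinity_iff hG o, Set.ofPred_forall]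
  exact MeasurableSet.iInter fun n =>
    measurableSet_far Set.univ (finite_ball hG o n) fun f => ∃ u ∈ L, f u

/-- The event that there is an infinite cluster. -/
def percolates (G : SimpleGraph V) : Set (Config G) :=
  {ω | ∃ v, ConnectedToInfinity (openEdges ω) {v}}

theorem percolates_eq [G.LocallyFinite] (hG : G.Connected) (o : V) :
    percolates G = ⋃ n, {ω | ConnectedToInfinity (openEdges ω) (ball G o n)} := by
  ext ω
  simp only [percolates, Set.mem_iUnion, Set.mem_ofPred_eq]
  constructor
  · rintro ⟨v, hv⟩
    exact ⟨G.dist o v, hv.mono (by rintro _ rfl; exact le_refl (G.dist o _))⟩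
  · rintro ⟨n, hn⟩
    obtain ⟨u, -, hu⟩ := hn.exists_singleton (finite_ball hG o n)
    exact ⟨u, hu⟩

/-- After a change on F, the old infinite cluster of v is covered by the new clusters of v and of
the finitely many endpoints of edges of F, so one of these is infinite. -/
theorem determined_percolates {F : Set G.edgeSet} (hF : F.Finite) :
    Determined (percolates G) Fᶜ := by
  rintro x y hxy ⟨v, hv⟩
  by_contra hc
  have hc' : ∀ u, ¬ ConnectedToInfinity (openEdges y) {u} := fun u hu => hc ⟨u, hu⟩
  set E : Set V := {u | ∃ e ∈ F, u ∈ (e : Sym2 V)}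
  have hE : E.Finite := by
    have : E ⊆ ⋃ e ∈ F, {u | u ∈ (e : Sym2 V)} := by
      rintro u ⟨e, he, hu⟩
      exact Set.mem_biUnion he hu
    refine (hF.biUnion fun e _ => ?_).subset this
    induction (e : Sym2 V) using Sym2.ind with
    | _ a b =>
      refine (Set.toFinite {a, b}).subset fun u hu => ?_
      simpa using hu
  have hL : (E ∪ {v}).Finite := hE.union (Set.finite_singleton v)
  refine absurd (?_ : ConnectedToInfinity (openEdges y) (E ∪ {v})) fun h => by
    obtain ⟨u, -, hu⟩ := h.exists_singleton hL
    exact hc' u hu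
  have key : ∀ a w, (SimpleGraph.fromEdgeSet (openEdges x)).Reachable a w →
      ∃ u ∈ E ∪ {a}, (SimpleGraph.fromEdgeSet (openEdges y)).Reachable u w := by
    intro a w hr
    rw [SimpleGraph.reachable_iff_reflTransGen] at hr
    induction hr using Relation.ReflTransGen.head_induction_on with
    | refl => exact ⟨w, Or.inr rfl, SimpleGraph.Reachable.refl _⟩
    | @head a c hac _ ih =>
      obtain ⟨u, hu | rfl, hr⟩ := ih
      · exact ⟨u, Or.inl hu, hr⟩
      · rw [SimpleGraph.fromEdgeSet_adj] at hac
        obtain ⟨⟨he, ho⟩, hne⟩ := hac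
        by_cases hF : (⟨s(a, u), he⟩ : G.edgeSet) ∈ F
        · exact ⟨u, Or.inl ⟨_, hF, Sym2.mem_mk_right _ _⟩, hr⟩
        · refine ⟨a, Or.inr rfl, SimpleGraph.Reachable.trans (SimpleGraph.Adj.reachable ?_) hr⟩
          rw [SimpleGraph.fromEdgeSet_adj]
          exact ⟨⟨he, by rw [← hxy _ hF]; exact ho⟩, hne⟩
  refine Set.Infinite.mono ?_ hv
  rintro w ⟨_, rfl, hr⟩
  exact key _ w hr

instance (p : unitInterval) : IsProbabilityMeasure (percMeasure G p) := by
  unfold percMeasure; infer_instance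

/-- The absence of an infinite cluster is a tail event, hence independent of the event A n that o is
connected to the outside of the n-ball. As n grows, A n decreases to the event that o percolates,
which is incompatible with that absence; so the product of the two probabilities is zero. -/
theorem percolates_ae [G.LocallyFinite] (hG : G.Connected)
    (hp : 0 < (percMeasure G p).real {ω | ConnectedToInfinity (openEdges ω) {o}}) :
    (percMeasure G p).real (percolates G)ᶜ = 0 := by
  set A : ℕ → Set (Config G) := fun n =>
    {ω | ∃ u ∈ ({o} : Set V), Far (ball G o n) (openIn Set.univ ω) u}
  have mA : ∀ n, MeasurableSet (A n) := fun n =>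
    measurableSet_far Set.univ (finite_ball hG o n) fun f => ∃ u ∈ ({o} : Set V), f u
  have mI : MeasurableSet (percolates G) := by
    rw [percolates_eq hG o]
    exact MeasurableSet.iUnion fun n => measurableSet_connectedToInfinity hG _
  have hA : {ω : Config G | ConnectedToInfinity (openEdges ω) {o}} = ⋂ n, A n := by
    ext ω
    rw [Set.mem_iInter]
    exact connectedToInfinity_iff hG o
  have hind : ∀ n, (percMeasure G p).real ((percolates G)ᶜ ∩ A n) =
      (percMeasure G p).real (percolates G)ᶜ * (percMeasure G p).real (A n) := fun n =>
    indep_of_determined (fun _ => p)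
      (determined_percolates (finite_edges_meeting (finite_ball hG o n))).compl
      (determined_far Set.univ (ball G o n) fun f => ∃ u ∈ ({o} : Set V), f u)
      disjoint_compl_left mI.compl (mA n)
  have hanti : Antitone fun n => (percolates G)ᶜ ∩ A n := by
    intro m n hmn
    refine Set.inter_subset_inter_right _ ?_
    rintro ω ⟨u, hu, w, hw, hr⟩
    exact ⟨u, hu, w, fun h => hw (ball_mono hmn h), hr⟩
  have hlim := tendsto_measure_iInter_atTop (μ := percMeasure G p)
    (s := fun n => (percolates G)ᶜ ∩ A n) (fun n => (mI.compl.inter (mA n)).nullMeasurableSet)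
    hanti ⟨0, measure_ne_top _ _⟩
  have hempty : ⋂ n, (percolates G)ᶜ ∩ A n = ∅ := by
    rw [← Set.inter_iInter, ← hA]
    ext ω
    simp only [Set.mem_inter_iff, Set.mem_compl_iff, Set.mem_empty_iff_false, iff_false, not_and]
    exact fun h h' => h ⟨o, h'⟩
  rw [hempty, measure_empty] at hlim
  have hlim' := (ENNReal.tendsto_toReal ENNReal.zero_ne_top).comp hlim
  refine le_antisymm ?_ measureReal_nonneg
  have h0 : (percMeasure G p).real (percolates G)ᶜ *
      (percMeasure G p).real {ω | ConnectedToInfinity (openEdges ω) {o}} ≤ 0 := by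
    refine ge_of_tendsto' hlim' fun n => ?_
    change _ ≤ (percMeasure G p).real ((percolates G)ᶜ ∩ A n)
    rw [hind n, hA]
    exact mul_le_mul_of_nonneg_left (measureReal_mono (Set.iInter_subset _ n)) measureReal_nonneg
  exact nonpos_of_mul_nonpos_left h0 hp

theorem exists_ball_connectedToInfinity [G.LocallyFinite] (hG : G.Connected)
    (hp : 0 < (percMeasure G p).real {ω | ConnectedToInfinity (openEdges ω) {o}}) {δ : ℝ}
    (hδ : 0 < δ) :
    ∃ n, (percMeasure G p).real {ω | ¬ ConnectedToInfinity (openEdges ω) (ball G o n)} ≤ δ := by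
  have hlim := tendsto_measure_iInter_atTop (μ := percMeasure G p)
    (s := fun n => {ω | ¬ ConnectedToInfinity (openEdges ω) (ball G o n)})
    (fun n => (measurableSet_connectedToInfinity hG _).compl.nullMeasurableSet)
    (fun m n hmn ω h h' => h (h'.mono (ball_mono hmn))) ⟨0, measure_ne_top _ _⟩
  have h0 : ⋂ n, {ω : Config G | ¬ ConnectedToInfinity (openEdges ω) (ball G o n)} =
      (percolates G)ᶜ := by
    rw [percolates_eq hG o, Set.compl_iUnion]
    rfl
  have h1 : (percMeasure G p) (percolates G)ᶜ = 0 := by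
    have := percolates_ae hG hp
    rwa [measureReal_eq_zero_iff] at this
  rw [h0, h1] at hlim
  have hlim' := (ENNReal.tendsto_toReal ENNReal.zero_ne_top).comp hlim
  obtain ⟨n, hn⟩ := (hlim'.eventually_le_const (u := δ) (by simpa using hδ)).exists
  exact ⟨n, hn⟩

end ZeroOne

/-! ### Union of the three fields, and uniformity over the vertices -/

section Transitivity

variable {V : Type*} {G : SimpleGraph V} {p s q : unitInterval} {o : V}

/-- Serves both to extract field 0 and to show that graph automorphisms preserve the percolation
measure. -/
theorem bernProd_map_comp {ι κ : Type*} (a : ι → unitInterval) {f : κ → ι}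
    (hf : Function.Injective f) :
    (bernProd a).map (fun (ω : ι → Bool) k => ω (f k)) = bernProd (a ∘ f) := by
  have h1 : iIndepFun (fun i (ω : ι → Bool) => ω i) (bernProd a) :=
    iIndepFun_infinitePi (P := fun i => bernoulliMeasure true false (a i))
      (X := fun _ x => x) (fun _ => measurable_id)
  have h2 := (h1.precomp hf).map_fun_eq_infinitePi_map fun k => measurable_pi_apply (f k)
  refine h2.trans ?_
  unfold bernProd
  congr 1
  funext k
  exact Measure.infinitePi_map_eval (fun i => bernoulliMeasure true false (a i)) (f k)

theorem eq_bernoulliMeasure (ν : Measure Bool) [IsProbabilityMeasure ν]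
    (h : ν.real {false} = 1 - q) : ν = bernoulliMeasure true false q := by
  have h' : (bernoulliMeasure true false q).real {false} = 1 - (q : ℝ) := by
    rw [bernoulliMeasure_real_apply _ (MeasurableSet.singleton _)]
    simp
  have e : ({true} : Set Bool) = {false}ᶜ := by ext b; cases b <;> simp
  refine Measure.ext_of_singleton fun b => ?_
  rw [← measureReal_eq_measureReal_iff]
  cases b
  · rw [h, h']
  · rw [e, probReal_compl_eq_one_sub (MeasurableSet.singleton _),
      probReal_compl_eq_one_sub (MeasurableSet.singleton _), h, h']

/-- The configuration of the edges that are open in at least one of the three fields. -/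
def orField (ω : Coord G → Bool) : Config G := fun e => ω (e, 0) || (ω (e, 1) || ω (e, 2))

theorem measurable_orField : Measurable (orField (G := G)) := by
  refine measurable_pi_iff.2 fun e => ?_
  have h : Measurable fun x : Fin 3 → Bool => x 0 || (x 1 || x 2) := measurable_of_finite _
  have h' : Measurable fun (ω : Coord G → Bool) (k : Fin 3) => ω (e, k) :=
    measurable_pi_iff.2 fun k => measurable_pi_apply (e, k)
  exact h.comp h'

theorem fieldMeasure_map_zero :
    (fieldMeasure G p s).map (fun ω e => ω (e, 0)) = percMeasure G p := by
  have := bernProd_map_comp (fieldParam G p s) (f := fun e : G.edgeSet => ((e, 0) : Coord G))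
    fun _ _ h => (Prod.ext_iff.1 h).1
  rw [this]
  unfold bernProd percMeasure
  rfl

/-- Grouping the coordinates by edge keeps the edges independent, and an edge is closed exactly when
its three copies are. -/
theorem fieldMeasure_map_orField (h : (1 - (p : ℝ)) * (1 - s) ^ 2 = 1 - q) :
    (fieldMeasure G p s).map orField = percMeasure G q := by
  set μ : G.edgeSet → Fin 3 → Measure Bool := fun _ k =>
    bernoulliMeasure true false (if k = 0 then p else s)
  set f : (Fin 3 → Bool) → Bool := fun x => x 0 || (x 1 || x 2)
  have hf : Measurable f := measurable_of_finite _
  have h1 : (fieldMeasure G p s).map (MeasurableEquiv.curry G.edgeSet (Fin 3) Bool) =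
      Measure.infinitePi fun e => Measure.infinitePi fun k => μ e k := Measure.infinitePi_map_curry μ
  have h2 : (orField (G := G)) = (fun x e => f (x e)) ∘ MeasurableEquiv.curry G.edgeSet (Fin 3) Bool :=
    rfl
  have h3 : Measurable fun (x : G.edgeSet → Fin 3 → Bool) e => f (x e) :=
    measurable_pi_iff.2 fun e => hf.comp (measurable_pi_apply e)
  rw [h2, ← Measure.map_map h3 (MeasurableEquiv.measurable _), h1,
    Measure.infinitePi_map_pi (fun e => Measure.infinitePi fun k => μ e k) fun _ => hf]
  unfold percMeasure
  congr 1
  funext e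
  have : IsProbabilityMeasure ((Measure.infinitePi fun k => μ e k).map f) :=
    Measure.isProbabilityMeasure_map hf.aemeasurable
  refine eq_bernoulliMeasure _ ?_
  rw [map_measureReal_apply hf (MeasurableSet.singleton _)]
  have h4 := bernProd_all (fun k : Fin 3 => if k = 0 then p else s) Finset.univ fun _ => false
  have h5 : f ⁻¹' {false} = {ω | ∀ i ∈ Finset.univ, ω i = false} := by
    ext x
    simp [f, Fin.forall_fin_succ]
  rw [h5]
  refine h4.trans ?_
  rw [← h]
  simp [Fin.prod_univ_three]
  ring

theorem dist_map_le (hG : G.Connected) (f : G →g G) (u v : V) : G.dist (f u) (f v) ≤ G.dist u v := by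
  obtain ⟨w, hw⟩ := (hG u v).exists_walk_length_eq_dist
  rw [← hw, ← SimpleGraph.Walk.length_map f w]
  exact G.dist_le _

theorem image_ball_subset (hG : G.Connected) (φ : G ≃g G) (o : V) (n : ℕ) :
    φ '' ball G o n ⊆ ball G (φ o) n := by
  rintro _ ⟨v, hv, rfl⟩
  exact (dist_map_le hG φ.toHom o v).trans hv

theorem finite_edgesNear [G.LocallyFinite] (hG : G.Connected) (m : ℕ) (c : V) :
    (edgesNear G m c).Finite := by
  refine ((finite_edges_meeting (G := G) (finite_ball hG c m)).image Subtype.val).subset fun e he => ?_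
  exact ⟨⟨e, he.1⟩, he.2, rfl⟩

theorem ncard_edgesNear_le [G.LocallyFinite] (hG : G.Connected) (φ : G ≃g G) (m : ℕ) (o : V) :
    (edgesNear G m (φ o)).ncard ≤ (edgesNear G m o).ncard := by
  refine Set.ncard_le_ncard_of_injOn (Sym2.map φ.symm) (fun e he => ?_)
    (Sym2.map.injective φ.symm.injective).injOn (finite_edgesNear hG m o)
  obtain ⟨he, v, hv, hd⟩ := he
  refine ⟨(φ.symm.toHom.mapEdgeSet ⟨e, he⟩).2, φ.symm v, Sym2.mem_map.2 ⟨v, hv, rfl⟩, ?_⟩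
  have := dist_map_le hG φ.symm.toHom (φ o) v
  have e1 : φ.symm.toHom (φ o) = o := φ.symm_apply_apply o
  rw [e1] at this
  exact this.trans hd

theorem connectedToInfinity_image (φ : G ≃g G) {ω : Config G} {L : Set V}
    (h : ConnectedToInfinity (openEdges fun e : G.edgeSet => ω (φ.mapEdgeSet e)) L) :
    ConnectedToInfinity (openEdges ω) (φ '' L) := by
  refine Set.Infinite.mono ?_ (Set.Infinite.image φ.injective.injOn h)
  rintro _ ⟨v, ⟨u, hu, hr⟩, rfl⟩
  refine ⟨φ u, Set.mem_image_of_mem _ hu, ?_⟩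
  refine hr.map (G' := SimpleGraph.fromEdgeSet (openEdges ω)) ⟨φ, ?_⟩
  intro a b hab
  rw [SimpleGraph.fromEdgeSet_adj] at hab ⊢
  obtain ⟨⟨he, ho⟩, hne⟩ := hab
  exact ⟨⟨(φ.mapEdgeSet ⟨s(a, b), he⟩).2, ho⟩, φ.injective.ne hne⟩

theorem ball_connected_le [G.LocallyFinite] (hG : G.Connected) (φ : G ≃g G) (o : V) (n : ℕ) :
    (percMeasure G p).real {ω | ¬ ConnectedToInfinity (openEdges ω) (ball G (φ o) n)} ≤
      (percMeasure G p).real {ω | ¬ ConnectedToInfinity (openEdges ω) (ball G o n)} := by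
  have h : (percMeasure G p).map (fun (ω : Config G) e => ω (φ.mapEdgeSet e)) = percMeasure G p :=
    bernProd_map_comp (fun _ => p) φ.mapEdgeSet.injective
  conv_rhs => rw [← h]
  rw [map_measureReal_apply (measurable_pi_iff.2 fun e => measurable_pi_apply _)
    (measurableSet_connectedToInfinity hG _).compl]
  exact measureReal_mono fun ω hω h =>
    hω ((connectedToInfinity_image φ h).mono (image_ball_subset hG φ o n))

/-- Transitivity transports the estimate at o to a ball around any w, and enlarging this ball to b
only helps. The factor (1 - p)^r cancels the cost of closing the exits. -/
theorem fewOutBound_of_ball [G.LocallyFinite] (hG : G.Connected) (htrans : IsTransitive G) {R r : ℕ}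
    {η : ℝ} (hp1 : (p : ℝ) < 1)
    (h : (percMeasure G p).real {ω | ¬ ConnectedToInfinity (openEdges ω) (ball G o R)} ≤
      (1 - (p : ℝ)) ^ r * η) : FewOutBound G p s R r η := by
  intro U b w hU hb hw
  have hpos : 0 < (1 - (p : ℝ)) ^ r := pow_pos (by linarith) r
  refine le_of_mul_le_mul_left (measureReal_outEdges_lt hU hb r ?_) hpos
  obtain ⟨φ, rfl⟩ := htrans o w
  refine le_trans ?_ ((ball_connected_le hG φ o R).trans h)
  rw [← fieldMeasure_map_zero (s := s), map_measureReal_apply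
    (measurable_pi_iff.2 fun e => measurable_pi_apply _)
    (measurableSet_connectedToInfinity hG _).compl]
  refine measureReal_mono fun ω hω h => hω ?_
  refine Set.Infinite.mono ?_ h
  rintro v ⟨u, hu, hr⟩
  refine ⟨u, hw u hu, hr.mono ?_⟩
  intro a c hac
  rw [SimpleGraph.fromEdgeSet_adj] at hac
  obtain ⟨⟨he, ho⟩, -⟩ := hac
  exact ⟨(⟨s(a, c), he⟩, 0), ⟨rfl, ho⟩, rfl⟩

theorem exists_fewOutBound [G.LocallyFinite] (hG : G.Connected) (htrans : IsTransitive G)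
    (hp : 0 < (percMeasure G p).real {ω | ConnectedToInfinity (openEdges ω) {o}})
    (hp1 : (p : ℝ) < 1) (s : unitInterval) (r : ℕ) {η : ℝ} (hη : 0 < η) :
    ∃ R, FewOutBound G p s R r η := by
  obtain ⟨R, hR⟩ := exists_ball_connectedToInfinity hG hp
    (mul_pos (pow_pos (sub_pos.2 hp1) r) hη)
  exact ⟨R, fewOutBound_of_ball hG htrans hp1 hR⟩

theorem ncard_linkSet_le [G.LocallyFinite] (hG : G.Connected) (S Λ U : Set V) (R : ℕ) (x : V)
    (b : Set V) : (linkSet G S Λ U R x b).ncard ≤ (edgesNear G (R + 1) x).ncard := by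
  refine Set.ncard_le_ncard_of_injOn (fun i => (i.1 : Sym2 V)) (fun i hi => ?_) ?_
    (finite_edgesNear hG _ _)
  · obtain ⟨v, hv⟩ := Sym2.exists_mem' (i.1 : Sym2 V)
    exact ⟨i.1.2, v, hv, (hi.2.1 v hv).1⟩
  · intro i hi j hj h
    exact Prod.ext (Subtype.ext h) (hi.1.trans hj.1.symm)

end Transitivity

/-! ### From finite balls to infinity, and the choice of constants -/

section Conclusion

variable {V : Type*} {G : SimpleGraph V} {p s q : unitInterval} {o : V} {S Λ : Set V}

/-- The vertices outside Λ ∪ S count as explored from the start: each is its own witness of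
connection to Λᶜ. -/
theorem explored_initial (S Λ : Set V) : Explored G S Λ (Λ \ S) ⊥ ∅ where
  subset := Set.sdiff_subset
  notMem _ hv := hv.2
  adj _ _ h := h.elim
  cover v hS hU := Or.inl ⟨v, fun h => hU ⟨h, hS⟩, SimpleGraph.Reachable.refl _⟩

theorem finalGraph_le (R : ℕ) (ω : Coord G → Bool) :
    finalGraph ⊥ (aliveSet G S Λ (Λ \ S) R ∅) ω ≤ openIn (innerEdges G Sᶜ) (orField ω) := by
  rintro u v (h | ⟨⟨e, k⟩, ⟨hA, ho⟩, he⟩)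
  · exact h.elim
  have hS : ∀ v ∈ (e : Sym2 V), v ∉ S := by
    rcases hA with (hA | hA) | hA
    exacts [fun v hv => (hA.2 v hv).2, hA.2.1, hA.2.1]
  have hG : s(u, v) ∈ G.edgeSet := he ▸ e.2
  have he' : e = ⟨s(u, v), hG⟩ := Subtype.ext he
  rw [openIn_adj]
  refine ⟨⟨hG, fun w hw => hS w (he ▸ hw)⟩, hG, ?_⟩
  rw [← he']
  fin_cases k <;> simp_all [orField]

theorem touchedEdges_anti {Λ' : Set V} (h : Λ ⊆ Λ') (K : SimpleGraph V) :
    touchedEdges G S Λ' K ⊆ touchedEdges G S Λ K :=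
  fun _ ⟨he, v, hv, hS, w, hw, hr⟩ => ⟨he, v, hv, hS, w, fun h' => hw (h h'), hr⟩

/-- The event that fewer than `t` edges of `∂S` are connected to the complement of the ball of radius
`n` off `S`. -/
def fewTouched (G : SimpleGraph V) (S : Set V) (o : V) (t n : ℕ) : Set (Config G) :=
  {ω | (touchedEdges G S (ball G o n) (openIn (innerEdges G Sᶜ) ω)).ncard < t}

theorem measurableSet_fewTouched [G.LocallyFinite] (hG : G.Connected) (S : Set V) (o : V) (t n : ℕ) :
    MeasurableSet (fewTouched G S o t n) :=
  measurableSet_far (innerEdges G Sᶜ) (finite_ball hG o n) fun f =>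
    {e | e ∈ edgeBoundary G S ∧ ∃ v ∈ e, v ∉ S ∧ f v}.ncard < t

theorem fewTouched_le [G.LocallyFinite] (hG : G.Connected) (hS : S.Finite) {n : ℕ}
    (hSn : S ⊆ ball G o n) (hpq : (1 - (p : ℝ)) * (1 - s) ^ 2 = 1 - q) {R r : ℕ} {η : ℝ}
    (hη : FewOutBound G p s R r η) (hη0 : 0 ≤ η) (hr : 0 < r) (h4 : η ≤ 1 / 4)
    (hsmall : η + (1 - (s : ℝ)) ^ r ≤ (s : ℝ) ^ 2 / 32) {t N m k : ℕ}
    (hN : ∀ c, (edgesNear G (2 * R + 2) c).ncard ≤ N) (hm : ∀ c, (edgesNear G (R + 1) c).ncard ≤ m)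
    (ht : t + N * k ≤ isoperimetric G S) :
    (percMeasure G q).real (fewTouched G S o t n) ≤
      2 ^ t * (1 - (s : ℝ) ^ m * ((s : ℝ) ^ 2 / 32)) ^ k := by
  rw [← fieldMeasure_map_orField hpq, map_measureReal_apply measurable_orField
    (measurableSet_fewTouched hG S o t n)]
  have hρ : 0 ≤ 1 - (s : ℝ) ^ m * ((s : ℝ) ^ 2 / 32) := by
    have h1 : (s : ℝ) ^ m ≤ 1 := pow_le_one₀ s.2.1 s.2.2
    have h2 : (s : ℝ) ^ 2 ≤ 1 := pow_le_one₀ s.2.1 s.2.2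
    nlinarith [pow_nonneg s.2.1 m, sq_nonneg (s : ℝ)]
  have h := touched_lt_prob_le hG (finite_ball hG o n) hS hSn hη hη0 hr h4 hsmall (t := t) (N := N)
    (m := m) (fun c => ⟨finite_edgesNear hG _ c, hN c⟩)
    (fun U x b => (ncard_linkSet_le hG _ _ _ _ _ _).trans (hm x)) k _ ⊥ ∅ ∅
    (explored_initial S (ball G o n)) (by simpa using ht)
  refine (measureReal_mono fun ω hω => ?_).trans (h.trans ?_)
  · exact (Set.ncard_le_ncard (touchedEdges_mono (finalGraph_le R ω))
      (finite_touchedEdges hS _)).trans_lt hω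
  · refine mul_le_mul_of_nonneg_right ?_ (pow_nonneg hρ k)
    rw [Finset.card_empty, pow_zero, one_mul]
    exact div_le_self (by positivity) (one_le_pow₀ one_le_two)

/-- Each of the finitely many boundary edges not connected to infinity has a finite cluster, so one
ball contains all of these clusters; beyond it, only edges counted by Ψ are touched. -/
theorem touches_lt_subset [G.LocallyFinite] (hS : S.Finite) (o : V) (t n₀ : ℕ) :
    {ω : Config G | touches S ω < t} ⊆ ⋃ n, fewTouched G S o t (n₀ + n) := by
  intro ω hω
  have h : ∀ e : Sym2 V, ∃ n, ¬ ConnectedToInfinity (openEdges ω ∩ innerEdges G Sᶜ) {v | v ∈ e} →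
      ∀ m, n ≤ m → ∀ u ∈ e, ¬ Far (ball G o m) (openIn (innerEdges G Sᶜ) ω) u := by
    intro e
    by_cases hc : ConnectedToInfinity (openEdges ω ∩ innerEdges G Sᶜ) {v | v ∈ e}
    · exact ⟨0, fun h => absurd hc h⟩
    · obtain ⟨n, hn⟩ := exists_ball_not_far (G := G) hc o
      exact ⟨n, fun _ => hn⟩
  choose f hf using h
  obtain ⟨n, hn⟩ := ((edgeBoundary_finite G hS).image f).bddAbove
  refine Set.mem_iUnion.2 ⟨n, lt_of_le_of_lt (Set.ncard_le_ncard ?_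
    ((edgeBoundary_finite G hS).subset fun e he => he.1)) hω⟩
  rintro e ⟨he, v, hv, -, hfar⟩
  refine ⟨he, ?_⟩
  by_contra hc
  exact hf e hc (n₀ + n) ((hn (Set.mem_image_of_mem f he)).trans (Nat.le_add_left _ _)) v hv hfar

/-- As the ball grows fewer edges are touched, so the events increase and their union inherits the
uniform bound. -/
theorem touches_lt_le [G.LocallyFinite] (hS : S.Finite) {t n₀ : ℕ} {ε : ℝ}
    (h : ∀ n, n₀ ≤ n → (percMeasure G q).real (fewTouched G S o t n) ≤ ε) :
    (percMeasure G q).real {ω | touches S ω < t} ≤ ε := by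
  have hmono : Monotone fun n => fewTouched G S o t (n₀ + n) := fun m n hmn ω hω =>
    (Set.ncard_le_ncard (touchedEdges_anti (ball_mono (Nat.add_le_add_left hmn n₀)) _)
      (finite_touchedEdges hS _)).trans_lt hω
  have hlim := (ENNReal.tendsto_toReal (measure_ne_top (percMeasure G q) _)).comp
    (tendsto_measure_iUnion_atTop (μ := percMeasure G q) hmono)
  exact (measureReal_mono (touches_lt_subset hS o t n₀)).trans
    (le_of_tendsto' hlim fun n => h _ (Nat.le_add_right _ _))

theorem exists_sprinkling (hpq : p < q) (hq : q < 1) :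
    ∃ s : unitInterval, 0 < (s : ℝ) ∧ (1 - (p : ℝ)) * (1 - s) ^ 2 = 1 - q := by
  have h1 : (p : ℝ) < q := hpq
  have h2 : (q : ℝ) < 1 := hq
  have h3 : 0 < 1 - (p : ℝ) := by linarith
  have h4 : (1 - (q : ℝ)) / (1 - p) < 1 := by rw [div_lt_one h3]; linarith
  have h5 : 0 ≤ (1 - (q : ℝ)) / (1 - p) := div_nonneg (by linarith) h3.le
  have h6 : √((1 - (q : ℝ)) / (1 - p)) < 1 := by
    rw [Real.sqrt_lt' one_pos]
    simpa using h4
  refine ⟨⟨1 - √((1 - (q : ℝ)) / (1 - p)), by linarith, by linarith [Real.sqrt_nonneg ((1 - (q : ℝ)) / (1 - p))]⟩, by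
    simpa using h6, ?_⟩
  rw [sub_sub_cancel, Real.sq_sqrt h5, mul_div_cancel₀ _ h3.ne']

theorem exists_touches_lt_le [G.LocallyFinite] (hG : G.Connected) (htrans : IsTransitive G)
    (hp : 0 < (percMeasure G p).real {ω | ConnectedToInfinity (openEdges ω) {o}})
    (hpq : p < q) (hq : q < 1) {ε : ℝ} (hε : ε ∈ Set.Ioc (0 : ℝ) 1) :
    ∃ c : ℝ, 0 < c ∧ ∀ S : Set V, S.Finite → ∀ t : ℕ, t ≤ c * (isoperimetric G S : ℝ) →
      (percMeasure G q).real {ω | touches S ω < t} ≤ ε ^ t := by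
  obtain ⟨s, hs, hsq⟩ := exists_sprinkling hpq hq
  have hs1 : (s : ℝ) ≤ 1 := s.2.2
  -- The budget s²/32 is split evenly between η and (1 - s)^(r + 1); the exponent r + 1 ensures that
  -- the required number of exits is positive.
  obtain ⟨r, hr⟩ := exists_pow_lt_of_lt_one (show 0 < (s : ℝ) ^ 2 / 64 by positivity)
    (show 1 - (s : ℝ) < 1 by linarith)
  have hr' : (1 - (s : ℝ)) ^ (r + 1) ≤ (s : ℝ) ^ 2 / 64 :=
    (pow_le_pow_of_le_one (by linarith) (by linarith) (Nat.le_succ r)).trans hr.le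
  have hs2 : (s : ℝ) ^ 2 ≤ 1 := pow_le_one₀ hs.le hs1
  obtain ⟨R, hR⟩ := exists_fewOutBound hG htrans hp (lt_trans (show (p : ℝ) < q from hpq) hq) s
    (r + 1) (show 0 < (s : ℝ) ^ 2 / 64 by positivity)
  set m := (edgesNear G (R + 1) o).ncard
  set N := (edgesNear G (2 * R + 2) o).ncard
  set ρ := 1 - (s : ℝ) ^ m * ((s : ℝ) ^ 2 / 32)
  have hρ1 : ρ < 1 := sub_lt_self _ (by positivity)
  have hρ0 : 0 ≤ ρ := by
    have h1 : (s : ℝ) ^ m ≤ 1 := pow_le_one₀ hs.le hs1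
    have h2 : (s : ℝ) ^ m * ((s : ℝ) ^ 2 / 32) ≤ 1 * 1 :=
      mul_le_mul h1 (by linarith) (by positivity) zero_le_one
    simp only [ρ]
    linarith
  -- Spending k trials per required edge gives (2ρ^k)^t ≤ ε^t. The constant c below makes t + Nkt ≤
  -- Φ(S), the room needed for kt trials.
  obtain ⟨k, hk⟩ := exists_pow_lt_of_lt_one (half_pos hε.1) hρ1
  refine ⟨1 / (1 + N * k), by positivity, fun S hS t ht => ?_⟩
  have ht' : t + N * (k * t) ≤ isoperimetric G S := by
    rw [div_mul_eq_mul_div, one_mul, le_div_iff₀ (by positivity)] at ht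
    have : ((t + N * (k * t) : ℕ) : ℝ) ≤ isoperimetric G S := by
      push_cast
      linarith
    exact_mod_cast this
  obtain ⟨n₀, hn₀⟩ := exists_subset_ball (G := G) hS o
  refine touches_lt_le (o := o) (n₀ := n₀) hS fun n hn => ?_
  have near : ∀ j c, (edgesNear G j c).ncard ≤ (edgesNear G j o).ncard := by
    intro j c
    obtain ⟨φ, rfl⟩ := htrans o c
    exact ncard_edgesNear_le hG φ j o
  refine (fewTouched_le hG hS (hn₀.trans (ball_mono hn)) hsq hR (by positivity) (Nat.succ_pos r)
    (by linarith) (by linarith) (near _) (near _) ht').trans ?_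
  rw [pow_mul, ← mul_pow]
  exact pow_le_pow_left₀ (by positivity) (by change 2 * ρ ^ k ≤ ε; linarith) t

end Conclusion

end Percolation

theorem proposition2p1 {V : Type*} [Infinite V] (G : SimpleGraph V) [G.LocallyFinite]
    (hconn : G.Connected) (htrans : Percolation.IsTransitive G) (o : V) (p : unitInterval)
    (hp : 0 < (Percolation.percMeasure G p).real
      {ω | Percolation.ConnectedToInfinity (Percolation.openEdges ω) {o}})
    (q : unitInterval) (hpq : p < q) (hq : q < 1) (ε : ℝ) (hε : ε ∈ Set.Ioc (0 : ℝ) 1) :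
    ∃ c : ℝ, 0 < c ∧ ∀ S : Set V, S.Finite → ∀ t : ℕ, 0 < t →
      (t : ℝ) ≤ c * (Percolation.isoperimetric G S : ℝ) →
      (1 - ε) ^ t ≤ (Percolation.percMeasure G q).real {ω | t ≤ Percolation.touches S ω} := by
  obtain ⟨c, hc, h⟩ := Percolation.exists_touches_lt_le hconn htrans hp hpq hq hε
  refine ⟨c, hc, fun S hS t ht htc => ?_⟩
  have h1 := h S hS t htc
  -- Subadditivity, in place of the complement formula, requires no measurability of Ψ.
  have h2 := MeasureTheory.measureReal_union_le (μ := Percolation.percMeasure G q)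
    {ω | t ≤ Percolation.touches S ω} {ω | Percolation.touches S ω < t}
  have h3 : {ω | t ≤ Percolation.touches S ω} ∪ {ω | Percolation.touches S ω < t} =
      (Set.univ : Set (Percolation.Config G)) :=
    Set.eq_univ_of_forall fun ω => le_or_gt t (Percolation.touches S ω)
  rw [h3, MeasureTheory.probReal_univ] at h2
  have h4 : (1 - ε) ^ t ≤ 1 - ε :=
    pow_le_of_le_one (by linarith [hε.2]) (by linarith [hε.1]) ht.ne'
  have h5 : ε ^ t ≤ ε := pow_le_of_le_one hε.1.le hε.2 ht.ne'
  linarith
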